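/- Let $-\infty<a<b<\infty$, $\Omega=(a,b)$, $\delta_\Omega(x)=\mathrm{dist}(x,\partial\Omega)$ and $\alpha,\gamma>0$. Let $0\le K,M\in L^2(\Omega)$ with $M\in C(\Omega)$; put $h_a(x)=(x-a)h(x)$, $h_b(x)=(b-x)h(x)$ for $h\in\{K,M\}$, and $\mathcal M=\{x\in\Omega: M(x)>0\}$. Suppose that $\overline{\mathcal M}\subset\Omega$ and that $$\max\Big(\int_a^b M_a,\int_a^b M_b\Big)<\int_a^b K\,\delta_\Omega .$$ Then there exists $\lambda_0\in(0,\infty]$ with $$\lambda_0\ \ge\ \Big(\frac{\mathrm{dist}(\mathcal M,\partial\Omega)}{b-a}\Big)^{\gamma}\ \frac{\Big(\int_a^b K\delta_\Omega-\max\big(\int_a^b M_a,\int_a^b M_b\big)\Big)^{\gamma}}{\Big(\tfrac12\big(\max\big(\int_a^b K_a,\int_a^b K_b\big)-\int_a^b M\delta_\Omega\big)\Big)^{\alpha\frac{1+\gamma}{1+\alpha}}}$$ (where $\mathrm{dist}(\emptyset,\partial\Omega)=\infty$, so that $\lambda_0=\infty$ if $M\equiv0$) such that for every real $\lambda$ with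 $0<\lambda\le\lambda_0$ the problem $$-u''=K(x)u^{-\alpha}-\lambda M(x)u^{-\gamma}\ \text{ in }\Omega,\qquad u>0\ \text{ in }\Omega,\qquad u=0\ \text{ on }\partial\Omega$$ has a solution $u\in C^1(\Omega)\cap C(\overline\Omega)$ in the sense of distributions, that is, $$\int_\Omega u'\varphi'=\int_\Omega\big(K u^{-\alpha}-\lambda M u^{-\gamma}\big)\varphi\qquad\text{for all }\varphi\in C_c^\infty(\Omega).$$ Moreover, if $K\delta_\Omega^{-\alpha},\,M\delta_\Omega^{-\gamma}\in L^r(\Omega)$ for some $r>1$, then this $u$ belongs to $W^{2,q}(\Omega)\cap P^\circ$ for some $q>1$, where $P^\circ$ is the interior, in the $C^1(\overline\Omega)$ norm, of the cone of nonnegative functions in $C^1_0(\overline\Omega)=\{u\in C^1(\overline\Omega): u=0\text{ on }\partial\Omega\}$. -/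

import Mathlib

open Set MeasureTheory TopologicalSpace
open scoped ENNReal Distributions

noncomputable section

namespace SingularODE

/-- The open interval `Ω = (a, b)` as an open subset of `ℝ`. -/
def Om (a b : ℝ) : Opens ℝ := ⟨Ioo a b, isOpen_Ioo⟩

/-- The boundary `∂Ω` of `Ω = (a, b)`. -/
def bdry (a b : ℝ) : Set ℝ := frontier (Ioo a b)

/-- `δ_Ω(x) = dist(x, ∂Ω)`. -/
def delta (a b x : ℝ) : ℝ := Metric.infDist x (bdry a b)

/-- `dist(S, ∂Ω)`, the infimum over `x ∈ S` of `dist(x, ∂Ω)`, in `[0, ∞]`;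
the distance of the empty set to `∂Ω` is `∞`. -/
def distToBdry (a b : ℝ) (S : Set ℝ) : ℝ≥0∞ := ⨅ x ∈ S, Metric.infEDist x (bdry a b)

/-- The set `{x ∈ Ω : M(x) > 0}`. -/
def posSet (a b : ℝ) (M : ℝ → ℝ) : Set ℝ := {x | x ∈ Ioo a b ∧ 0 < M x}

/-- `h ∈ L^q(Ω)`. -/
def InLp (a b : ℝ) (q : ℝ≥0∞) (h : ℝ → ℝ) : Prop :=
  MemLp h q (volume.restrict (Ioo a b))

/-- `h_a(x) = (x - a) h(x)`. -/
def leftWeight (a : ℝ) (h : ℝ → ℝ) (x : ℝ) : ℝ := (x - a) * h x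

/-- `h_b(x) = (b - x) h(x)`. -/
def rightWeight (b : ℝ) (h : ℝ → ℝ) (x : ℝ) : ℝ := (b - x) * h x

/-- `max (∫_a^b h_a, ∫_a^b h_b)`. -/
def maxWeight (a b : ℝ) (h : ℝ → ℝ) : ℝ :=
  max (∫ x in a..b, leftWeight a h x) (∫ x in a..b, rightWeight b h x)

/-- `∫_a^b h δ_Ω`. -/
def deltaWeight (a b : ℝ) (h : ℝ → ℝ) : ℝ := ∫ x in a..b, h x * delta a b x

/-- `u ∈ C¹(Ω) ∩ C(closure Ω)` is a solution, in the sense of distributions, of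
`-u'' = f(x, u)` in `Ω`, `u > 0` in `Ω`, `u = 0` on `∂Ω`.
The test functions `𝓓(Ω, ℝ)` are the smooth functions with compact support contained in `Ω`. -/
structure IsSolution (a b : ℝ) (f : ℝ → ℝ → ℝ) (u : ℝ → ℝ) : Prop where
  contDiffOn : ContDiffOn ℝ 1 u (Ioo a b)
  continuousOn : ContinuousOn u (closure (Ioo a b))
  pos : ∀ x ∈ Ioo a b, 0 < u x
  eq_zero : ∀ x ∈ bdry a b, u x = 0
  locallyIntegrableOn : LocallyIntegrableOn (fun x => f x (u x)) (Ioo a b)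
  weak_eq : ∀ φ : 𝓓(Om a b, ℝ),
    ∫ x in Ioo a b, deriv u x * deriv φ x = ∫ x in Ioo a b, f x (u x) * φ x

/-- The right-hand side `K(x) ξ^(-α) - lam M(x) ξ^(-γ)`. -/
def rhs (α γ lam : ℝ) (K M : ℝ → ℝ) (x ξ : ℝ) : ℝ :=
  K x * ξ ^ (-α) - lam * M x * ξ ^ (-γ)

/-- `g` is the weak derivative of order `j` of `u` in `Ω`. -/
def IsWeakDeriv (a b : ℝ) (j : ℕ) (u g : ℝ → ℝ) : Prop :=
  ∀ φ : 𝓓(Om a b, ℝ),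
    ∫ x in Ioo a b, u x * iteratedDeriv j φ x = (-1) ^ j * ∫ x in Ioo a b, g x * φ x

/-- `u ∈ W^{2,q}(Ω)`. -/
def MemW2 (a b : ℝ) (q : ℝ≥0∞) (u : ℝ → ℝ) : Prop :=
  InLp a b q u ∧
    (∃ g, InLp a b q g ∧ IsWeakDeriv a b 1 u g) ∧
    (∃ g, InLp a b q g ∧ IsWeakDeriv a b 2 u g)

/-- `u ∈ C¹₀(closure Ω)`: `u` is continuously differentiable on `[a, b]`
(with one-sided derivatives at the end points) and vanishes on `∂Ω`. -/
def IsC1Zero (a b : ℝ) (u : ℝ → ℝ) : Prop :=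
  ContDiffOn ℝ 1 u (Icc a b) ∧ ∀ x ∈ bdry a b, u x = 0

/-- `u ∈ P°`, the interior of the cone of nonnegative functions in `C¹₀(closure Ω)` with the
`C¹` norm: all `v ∈ C¹₀(closure Ω)` that are close enough to `u`, uniformly together with
their derivatives, are nonnegative. -/
def InConeInterior (a b : ℝ) (u : ℝ → ℝ) : Prop :=
  IsC1Zero a b u ∧ ∃ ε > 0, ∀ v : ℝ → ℝ, IsC1Zero a b v →
    (∀ x ∈ Icc a b, |v x - u x| < ε ∧
      |derivWithin v (Icc a b) x - derivWithin u (Icc a b) x| < ε) →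
    ∀ x ∈ Icc a b, 0 ≤ v x

end SingularODE

end

open Filter Topology Interval intervalIntegral

namespace SingularODE

/-! The solution lies above an explicit subsolution and is a limit of solutions with positive
boundary values. Write `δ(x) = min (x - a) (b - x)`, let `A` be `∫ K δ` minus the larger weighted
integral of `M`, and let `D` be half of the larger weighted integral of `K` minus `∫ M δ`. Let `φ`
solve `-φ'' = K - M` with zero boundary values. Bounds on the Green kernel (`mul_integral_le_green`,
`green_le_mul_max`) give `A δ / (b - a) ≤ φ ≤ 2 D δ / (b - a) ≤ D`.

Put `v = ε φ`, where `ε` is chosen so that `(ε D)^(-α) = ε`. Then `K v^(-α) ≥ ε K`. If `d` bounds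
`δ` from below where `M > 0`, then `v ≥ m = ε A d / (b - a)` there, and the bound on `lam` is
exactly `lam m^(-γ) ≤ ε`. So `-v'' = ε (K - M) ≤ K v^(-α) - lam M v^(-γ)`.

For small `τ > 0`, `exists_regularized` truncates the singular powers, solves with boundary value
`τ`, and shows by comparison that the truncations are inactive. The lower bound `v` is uniform in
`τ`; with the upper barriers of `SolvesOn.le_add_rpow_mul` and the compactness result
`exists_subseq_tendsto_solvesOn` it yields a limit that solves the singular equation and is
continuous up to the boundary.

The limit keeps the bound `u ≥ c δ`, `c > 0`. This dominates the right-hand side by `K δ^(-α)` and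
`M δ^(-γ)` up to constants, so `L^r` data give `W^{2,r}` and `C¹` up to the boundary; the same bound
places `u` in the interior of the cone. -/

/-- `u` has derivative `p` on `I` and `p` is absolutely continuous with derivative `-g`, in
integrated form: a Carathéodory solution of `-u'' = g` on `I`. -/
structure SolvesOn (I : Set ℝ) (u p g : ℝ → ℝ) : Prop where
  hasDerivAt : ∀ x ∈ I, HasDerivAt u (p x) x
  intervalIntegrable : ∀ x ∈ I, ∀ y ∈ I, IntervalIntegrable g volume x y
  sub_eq : ∀ x ∈ I, ∀ y ∈ I, p y - p x = -∫ t in x..y, g t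

/-! ### Calculus and comparison principle for integrated solutions. -/

namespace SolvesOn

variable {I J : Set ℝ} {u p g v q h : ℝ → ℝ} {a b c x y : ℝ}

theorem mono (hu : SolvesOn I u p g) (hJ : J ⊆ I) : SolvesOn J u p g :=
  ⟨fun x hx => hu.1 x (hJ hx), fun x hx y hy => hu.2 x (hJ hx) y (hJ hy),
    fun x hx y hy => hu.3 x (hJ hx) y (hJ hy)⟩

theorem sub (hu : SolvesOn I u p g) (hv : SolvesOn I v q h) :
    SolvesOn I (fun x => u x - v x) (fun x => p x - q x) (fun x => g x - h x) := by
  refine ⟨fun x hx => (hu.1 x hx).sub (hv.1 x hx), fun x hx y hy => (hu.2 x hx y hy).sub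
    (hv.2 x hx y hy), fun x hx y hy => ?_⟩
  rw [integral_sub (hu.2 x hx y hy) (hv.2 x hx y hy)]
  linarith [hu.3 x hx y hy, hv.3 x hx y hy]

theorem add (hu : SolvesOn I u p g) (hv : SolvesOn I v q h) :
    SolvesOn I (fun x => u x + v x) (fun x => p x + q x) (fun x => g x + h x) := by
  refine ⟨fun x hx => (hu.1 x hx).add (hv.1 x hx), fun x hx y hy => (hu.2 x hx y hy).add
    (hv.2 x hx y hy), fun x hx y hy => ?_⟩
  rw [intervalIntegral.integral_add (hu.2 x hx y hy) (hv.2 x hx y hy)]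
  linarith [hu.3 x hx y hy, hv.3 x hx y hy]

theorem const_mul (c : ℝ) (hu : SolvesOn I u p g) :
    SolvesOn I (fun x => c * u x) (fun x => c * p x) (fun x => c * g x) := by
  refine ⟨fun x hx => (hu.1 x hx).const_mul c, fun x hx y hy => (hu.2 x hx y hy).const_mul c,
    fun x hx y hy => ?_⟩
  rw [intervalIntegral.integral_const_mul]
  linear_combination c * hu.3 x hx y hy

theorem const (c : ℝ) : SolvesOn I (fun _ => c) (fun _ => 0) (fun _ => 0) :=
  ⟨fun x _ => hasDerivAt_const x c, fun _ _ _ _ => intervalIntegrable_const, by simp⟩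

theorem congr_ae (hu : SolvesOn I u p g) (hI : I.OrdConnected) (hgh : ∀ᵐ x, x ∈ I → g x = h x) :
    SolvesOn I u p h := by
  have key : ∀ x ∈ I, ∀ y ∈ I, ∀ᵐ t, t ∈ Ι x y → g t = h t := fun x hx y hy => by
    filter_upwards [hgh] with t ht hxy
    exact ht (hI.uIcc_subset hx hy (uIoc_subset_uIcc hxy))
  refine ⟨hu.1, fun x hx y hy => ?_, fun x hx y hy => ?_⟩
  · refine (hu.2 x hx y hy).congr_ae ?_
    exact (ae_restrict_iff' measurableSet_uIoc).2 (key x hx y hy)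
  · rw [hu.3 x hx y hy, integral_congr_ae (key x hx y hy)]

theorem absolutelyContinuous (hu : SolvesOn I u p g) (hI : I.OrdConnected) (hx : x ∈ I)
    (hy : y ∈ I) : AbsolutelyContinuousOnInterval p x y := by
  have h := (hu.2 x hx y hy).absolutelyContinuousOnInterval_intervalIntegral (c := x) (by simp)
  have h2 : AbsolutelyContinuousOnInterval (fun _ : ℝ => p x) x y :=
    (LipschitzWith.const (p x)).lipschitzOnWith.absolutelyContinuousOnInterval
  have h3 := h2.fun_sub h
  rw [absolutelyContinuousOnInterval_iff] at h3 ⊢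
  intro ε hε
  obtain ⟨δ, hδ, H⟩ := h3 ε hε
  refine ⟨δ, hδ, fun E hE hs => ?_⟩
  convert H E hE hs using 2 with i hi
  have hmem := hE.1 i hi
  have e : ∀ z ∈ uIcc x y, p x - ∫ t in x..z, g t = p z := fun z hz => by
    linarith [hu.3 x hx z (hI.uIcc_subset hx hy hz)]
  rw [e _ hmem.1, e _ hmem.2]

theorem continuousOn_deriv_uIcc (hu : SolvesOn I u p g) (hI : I.OrdConnected) (hx : x ∈ I)
    (hy : y ∈ I) : ContinuousOn p (uIcc x y) :=
  (hu.absolutelyContinuous hI hx hy).continuousOn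

theorem continuousOn (hu : SolvesOn I u p g) : ContinuousOn u I :=
  fun x hx => (hu.1 x hx).continuousAt.continuousWithinAt

theorem continuousOn_deriv (hu : SolvesOn I u p g) (hI : I.OrdConnected) (hIo : IsOpen I) :
    ContinuousOn p I := by
  intro x hx
  obtain ⟨ε, hε, hb⟩ := Metric.isOpen_iff.1 hIo x hx
  have h1 : x - ε / 2 ∈ I := hb (by simpa [abs_of_pos hε] using hε)
  have h2 : x + ε / 2 ∈ I := hb (by simpa [abs_of_pos hε] using hε)
  have := hu.continuousOn_deriv_uIcc hI h1 h2
  rw [uIcc_of_le (by linarith)] at this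
  exact (this.continuousAt (Icc_mem_nhds (by linarith) (by linarith))).continuousWithinAt

theorem ae_deriv_eq (hu : SolvesOn I u p g) (hI : I.OrdConnected) (hx : x ∈ I) (hy : y ∈ I) :
    ∀ᵐ t, t ∈ Ι x y → deriv p t = -g t := by
  -- The primitive formula for `p` is used on `uIcc x y`, which is a neighbourhood of `t` only when
  -- `t` is not an endpoint.
  have hne : ∀ᵐ t : ℝ, t ≠ x ∧ t ≠ y := by
    have h1 : ∀ᵐ t : ℝ, t ≠ x := by simp [ae_iff, measure_singleton]
    have h2 : ∀ᵐ t : ℝ, t ≠ y := by simp [ae_iff, measure_singleton]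
    filter_upwards [h1, h2] with t a b using ⟨a, b⟩
  filter_upwards [(hu.2 x hx y hy).ae_hasDerivAt_integral, hne] with t ht hn hxy
  have h1 := (ht (uIoc_subset_uIcc hxy) x (by simp)).const_sub (p x)
  refine HasDerivAt.deriv (h1.congr_of_eventuallyEq ?_)
  have hmem : uIcc x y ∈ 𝓝 t := by
    rcases le_total x y with hle | hle
    · rw [uIoc_of_le hle] at hxy
      rw [uIcc_of_le hle]
      exact Icc_mem_nhds hxy.1 (lt_of_le_of_ne hxy.2 hn.2)
    · rw [uIoc_of_ge hle] at hxy
      rw [uIcc_of_ge hle]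
      exact Icc_mem_nhds hxy.1 (lt_of_le_of_ne hxy.2 hn.1)
  filter_upwards [hmem] with z hz
  linarith [hu.3 x hx z (hI.uIcc_subset hx hy hz)]

/-- Integration by parts against an absolutely continuous function. -/
theorem integral_mul_deriv (hu : SolvesOn I u p g) (hI : I.OrdConnected) (hx : x ∈ I)
    (hy : y ∈ I) {f : ℝ → ℝ} (hf : AbsolutelyContinuousOnInterval f x y) :
    ∫ t in x..y, p t * deriv f t = p y * f y - p x * f x + ∫ t in x..y, g t * f t := by
  rw [(hu.absolutelyContinuous hI hx hy).integral_mul_deriv_eq_deriv_mul hf, sub_eq_add_neg,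
    ← intervalIntegral.integral_neg]
  congr 1
  refine integral_congr_ae ?_
  filter_upwards [hu.ae_deriv_eq hI hx hy] with t ht hxy
  rw [ht hxy]; ring

theorem integral_deriv (hu : SolvesOn I u p g) (hI : I.OrdConnected) (hx : x ∈ I)
    (hy : y ∈ I) : ∫ t in x..y, p t = u y - u x :=
  integral_eq_sub_of_hasDerivAt (fun t ht => hu.1 t (hI.uIcc_subset hx hy ht))
    (hu.continuousOn_deriv_uIcc hI hx hy).intervalIntegrable

/-- Integration by parts against `t - c`. The choices `c = a` and `c = b` produce the two halves of
the Green representation. -/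
theorem integral_sub_mul (hu : SolvesOn I u p g) (hI : I.OrdConnected) (hx : x ∈ I)
    (hy : y ∈ I) (c : ℝ) :
    ∫ t in x..y, (t - c) * g t = u y - u x - (y - c) * p y + (x - c) * p x := by
  have hL : LipschitzWith 1 (fun t : ℝ => t - c) :=
    LipschitzWith.of_dist_le_mul fun s t => by simp [Real.dist_eq]
  have h := hu.integral_mul_deriv hI hx hy (hL.lipschitzOnWith.absolutelyContinuousOnInterval)
  have hd : ∀ t : ℝ, deriv (fun t : ℝ => t - c) t = 1 := fun t => by simp
  simp only [hd, mul_one, hu.integral_deriv hI hx hy] at h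
  simp only [mul_comm _ (g _)]
  linarith

/-- Weak maximum principle: a function that is convex where it is positive, and is nonpositive at
both ends of an interval, is nonpositive on the interval. -/
theorem nonpos (hu : SolvesOn (Icc a b) u p g) (ha : u a ≤ 0) (hb : u b ≤ 0)
    (hg : ∀ᵐ x, x ∈ Ioo a b → 0 < u x → g x ≤ 0) : ∀ x ∈ Icc a b, u x ≤ 0 := by
  by_contra! hcon
  obtain ⟨y, hy, hy0⟩ := hcon
  have hc : ContinuousOn u (Icc a b) := hu.continuousOn
  obtain ⟨x₀, hx₀, hmax⟩ := isCompact_Icc.exists_isMaxOn ⟨y, hy⟩ hc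
  have hpos : 0 < u x₀ := hy0.trans_le (hmax hy)
  have hax : a < x₀ := lt_of_le_of_ne hx₀.1 (by rintro rfl; linarith)
  have hxb : x₀ < b := lt_of_le_of_ne hx₀.2 (by rintro rfl; linarith)
  have hp0 : p x₀ = 0 :=
    (hmax.isLocalMax (Icc_mem_nhds hax hxb)).hasDerivAt_eq_zero (hu.1 x₀ hx₀)
  -- Let `e` be the first point right of the positive maximum `x₀` where `u ≤ 0`. On `[x₀, e)` the
  -- function is positive, hence convex, and starts with slope `0`; so it cannot decrease to `u e ≤
  -- 0`.
  set S := Icc x₀ b ∩ u ⁻¹' Iic 0 with hS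
  have hSc : IsClosed S :=
    (hc.mono (Icc_subset_Icc hax.le le_rfl)).preimage_isClosed_of_isClosed isClosed_Icc
      isClosed_Iic
  have hSn : S.Nonempty := ⟨b, ⟨hxb.le, le_rfl⟩, hb⟩
  have hSb : BddBelow S := ⟨x₀, fun z hz => hz.1.1⟩
  have he := hSc.csInf_mem hSn hSb
  set e := sInf S
  have hlt : ∀ z ∈ Ico x₀ e, 0 < u z := fun z hz => by
    by_contra! hz0
    exact absurd (csInf_le hSb ⟨⟨hz.1, hz.2.le.trans he.1.2⟩, hz0⟩) (not_le.2 hz.2)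
  have hsub : Icc x₀ e ⊆ Icc a b := Icc_subset_Icc hax.le he.1.2
  have hpn : ∀ z ∈ Icc x₀ e, 0 ≤ p z := fun z hz => by
    have h1 := hu.3 x₀ hx₀ z (hsub hz)
    have h2 : ∫ t in x₀..z, g t ≤ 0 := by
      rw [← neg_nonneg, ← intervalIntegral.integral_neg]
      refine integral_nonneg_of_ae_restrict hz.1 ?_
      refine (ae_restrict_iff' measurableSet_Icc).2 ?_
      have hne : ∀ᵐ t : ℝ, t ≠ e := by simp [ae_iff, measure_singleton]
      filter_upwards [hg, hne] with t ht hn hm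
      have h3 : t < e := lt_of_le_of_ne (hm.2.trans hz.2) hn
      have := ht ⟨hax.trans_le hm.1, h3.trans_le he.1.2⟩ (hlt t ⟨hm.1, h3⟩)
      simpa using this
    linarith
  have hmono : MonotoneOn u (Icc x₀ e) := by
    refine monotoneOn_of_deriv_nonneg (convex_Icc _ _) (hc.mono hsub)
      (fun z hz => (hu.1 z (hsub (interior_subset hz))).differentiableAt.differentiableWithinAt) fun z hz => ?_
    rw [(hu.1 z (hsub (interior_subset hz))).deriv]
    exact hpn z (interior_subset hz)
  have h4 := hmono ⟨le_rfl, he.1.1⟩ ⟨he.1.1, le_rfl⟩ he.1.1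
  have h5 : u e ≤ 0 := he.2
  linarith

/-- Maximum principle for `u - v`. The inequality between the right-hand sides is needed only where
the conclusion would fail, so no monotonicity of the nonlinearity is required. -/
theorem le_of_le (hu : SolvesOn (Icc a b) u p g) (hv : SolvesOn (Icc a b) v q h) (ha : u a ≤ v a)
    (hb : u b ≤ v b) (hg : ∀ᵐ x, x ∈ Ioo a b → v x < u x → g x ≤ h x) :
    ∀ x ∈ Icc a b, u x ≤ v x := fun x hx => by
  have := (hu.sub hv).nonpos (a := a) (b := b) (by linarith) (by linarith)
    (by filter_upwards [hg] with t ht h1 h2; linarith [ht h1 (by linarith)]) x hx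
  linarith

end SolvesOn

/-! ### Boundary value problem with a Lipschitz right-hand side. -/

/-- The solution of `-u'' = g` with prescribed value and slope at `a`. -/
theorem solvesOn_primitive {g : ℝ → ℝ} (hg : Integrable g) (a A s : ℝ) :
    SolvesOn univ (fun x => A + ∫ y in a..x, (s - ∫ t in a..y, g t))
      (fun y => s - ∫ t in a..y, g t) g := by
  have hi : ∀ x y, IntervalIntegrable g volume x y := fun x y => hg.intervalIntegrable
  have hc : Continuous fun y => s - ∫ t in a..y, g t :=
    continuous_const.sub (intervalIntegral.continuous_primitive hi a)
  refine ⟨fun x _ => ?_, fun x _ y _ => hi x y, fun x _ y _ => ?_⟩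
  · exact (integral_hasDerivAt_right (hc.intervalIntegrable _ _)
      (hc.stronglyMeasurableAtFilter _ _) hc.continuousAt).const_add A
  · have := integral_interval_sub_left (hi a y) (hi a x)
    linarith

/-- Contraction estimate in the norm weighted by `exp (-k (t - a))`. As `L` is only square
integrable, Young's inequality with parameter `η` separates `L²` from the exponential, whose square
integrates to at most `1 / (2k)`. -/
theorem integral_mul_exp_le {L f : ℝ → ℝ} {k η a x y d : ℝ} (hk : 0 < k) (hη : 0 < η)
    (hL : Integrable fun t => L t ^ 2) (hay : a ≤ y) (hyx : y ≤ x) (hd : 0 ≤ d)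
    (hf : ∀ t ∈ Ioc a y, ‖f t‖ ≤ L t * (Real.exp (k * (t - a)) * d)) :
    ‖∫ t in a..y, f t‖ ≤
      Real.exp (k * (x - a)) * d * (η / 2 * ∫ t, L t ^ 2) +
        Real.exp (k * (x - a)) * d * (1 / (4 * k * η)) := by
  have hex : ∫ t in a..y, Real.exp (2 * k * (t - x)) ≤ 1 / (2 * k) := by
    have h1 : ∀ t ∈ uIcc a y, HasDerivAt (fun t => Real.exp (2 * k * (t - x)) / (2 * k))
        (Real.exp (2 * k * (t - x))) t := fun t _ => by
      have := (((hasDerivAt_id t).sub_const x).const_mul (2 * k)).exp.div_const (2 * k)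
      refine this.congr_deriv ?_
      field_simp
      simp
    rw [integral_eq_sub_of_hasDerivAt h1 (by apply Continuous.intervalIntegrable; fun_prop)]
    have h2 : Real.exp (2 * k * (y - x)) ≤ 1 := Real.exp_le_one_iff.2 (by nlinarith)
    have h3 : Real.exp (2 * k * (y - x)) / (2 * k) ≤ 1 / (2 * k) := by gcongr
    have h4 : 0 ≤ Real.exp (2 * k * (a - x)) / (2 * k) := by positivity
    linarith
  have hL2 : ∫ t in a..y, L t ^ 2 ≤ ∫ t, L t ^ 2 := by
    rw [integral_of_le hay]
    exact setIntegral_le_integral hL (Eventually.of_forall fun t => sq_nonneg _)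
  have hc : Continuous fun t => Real.exp (2 * k * (t - x)) := by fun_prop
  have hi1 : IntervalIntegrable (fun t => Real.exp (k * (x - a)) * d * (η / 2) * L t ^ 2)
    volume a y := (hL.intervalIntegrable).const_mul _
  have hi2 : IntervalIntegrable (fun t => Real.exp (k * (x - a)) * d * (1 / (2 * η)) *
    Real.exp (2 * k * (t - x))) volume a y := (hc.intervalIntegrable _ _).const_mul _
  refine (norm_integral_le_of_norm_le hay (ae_of_all _ fun t ht => ?_) (hi1.add hi2)).trans ?_
  · refine (hf t ht).trans ?_
    have e1 : Real.exp (k * (t - a)) = Real.exp (k * (x - a)) * Real.exp (k * (t - x)) := by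
      rw [← Real.exp_add]; ring_nf
    have e2 : Real.exp (2 * k * (t - x)) = Real.exp (k * (t - x)) ^ 2 := by
      rw [sq, ← Real.exp_add]; ring_nf
    rw [e1, e2]
    set X := Real.exp (k * (t - x))
    have h5 : L t * X ≤ η / 2 * L t ^ 2 + 1 / (2 * η) * X ^ 2 := by
      have : η / 2 * L t ^ 2 + 1 / (2 * η) * X ^ 2 - L t * X = (η * L t - X) ^ 2 / (2 * η) := by
        field_simp; ring
      have h6 : 0 ≤ (η * L t - X) ^ 2 / (2 * η) := by positivity
      linarith
    have h7 : 0 ≤ Real.exp (k * (x - a)) * d := by positivity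
    nlinarith [mul_le_mul_of_nonneg_left h5 h7]
  · rw [intervalIntegral.integral_add hi1 hi2, intervalIntegral.integral_const_mul,
      intervalIntegral.integral_const_mul]
    have h7 : 0 ≤ Real.exp (k * (x - a)) * d := by positivity
    have h8 : Real.exp (k * (x - a)) * d * (1 / (2 * η)) *
        (∫ t in a..y, Real.exp (2 * k * (t - x))) ≤
        Real.exp (k * (x - a)) * d * (1 / (2 * η)) * (1 / (2 * k)) := by gcongr
    have h9 : Real.exp (k * (x - a)) * d * (η / 2) * (∫ t in a..y, L t ^ 2) ≤
        Real.exp (k * (x - a)) * d * (η / 2) * ∫ t, L t ^ 2 := by gcongr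
    have h10 : 1 / (2 * η) * (1 / (2 * k)) = 1 / (4 * k * η) := by field_simp; ring
    rw [mul_assoc _ (1 / (2 * η)) (1 / (2 * k)), h10] at h8
    linarith

/-- The Dirichlet problem `-u'' = h(x, u)`, `u(a) = A`, `u(b) = B`, for a bounded right-hand side
that is Lipschitz in `u`, by shooting. -/
theorem exists_solvesOn_boundary {a b : ℝ} (hab : a < b) {h : ℝ → ℝ → ℝ} {H L : ℝ → ℝ}
    (hm : ∀ u : ℝ → ℝ, Continuous u → AEStronglyMeasurable (fun t => h t (u t)) volume)
    (hH : Integrable H) (hhH : ∀ t ξ, |h t ξ| ≤ H t)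
    (hL : Integrable fun t => L t ^ 2)
    (hhL : ∀ t ξ ζ, |h t ξ - h t ζ| ≤ L t * |ξ - ζ|) (A B : ℝ) :
    ∃ u p g, SolvesOn univ u p g ∧ (∀ t ∈ Icc a b, g t = h t (u t)) ∧ u a = A ∧ u b = B := by
  set Q := ∫ t, L t ^ 2 with hQ
  have hQ0 : 0 ≤ Q := integral_nonneg fun t => sq_nonneg _
  have hba : 0 < b - a := sub_pos.2 hab
  -- First `η` and then `k` make each of the two terms of `integral_mul_exp_le` contribute at most
  -- `1/4`, for a contraction constant `1/2`.
  obtain ⟨η, hη, hη1⟩ : ∃ η > 0, (b - a) * (η / 2 * Q) ≤ 1 / 4 := by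
    refine ⟨1 / (2 * (b - a) * (Q + 1)), by positivity, ?_⟩
    rw [show (b - a) * (1 / (2 * (b - a) * (Q + 1)) / 2 * Q) = 1 / 4 * (Q / (Q + 1)) by
      field_simp; ring]
    have : Q / (Q + 1) ≤ 1 := (div_le_one (by positivity)).2 (by linarith)
    linarith
  obtain ⟨k, hk, hk1⟩ : ∃ k > 0, (b - a) * (1 / (4 * k * η)) ≤ 1 / 4 := by
    refine ⟨(b - a) / η, by positivity, le_of_eq ?_⟩
    field_simp
  -- The unknown is `z = exp (-k (t - a)) u`, so the sup norm of `z` is the weighted norm of `u`; `E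
  -- z` recovers `u`.
  let E : C(Icc a b, ℝ) → ℝ → ℝ := fun z t => Real.exp (k * (t - a)) * IccExtend hab.le z t
  have hE : ∀ z, Continuous (E z) := fun z =>
    (by fun_prop : Continuous fun t => Real.exp (k * (t - a))).mul z.continuous.Icc_extend'
  have hint : ∀ z, Integrable fun t => h t (E z t) := fun z =>
    hH.mono' (hm _ (hE z)) (ae_of_all _ fun t => hhH t _)
  let N : C(Icc a b, ℝ) → ℝ → ℝ := fun z y => ∫ t in a..y, h t (E z t)
  have hN : ∀ z, Continuous (N z) := fun z =>
    intervalIntegral.continuous_primitive (fun _ _ => (hint z).intervalIntegrable) a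
  let U : ℝ → C(Icc a b, ℝ) → ℝ → ℝ := fun s z x => A + ∫ y in a..x, (s - N z y)
  have hU : ∀ s z, SolvesOn univ (U s z) (fun y => s - N z y) (fun t => h t (E z t)) := fun s z =>
    solvesOn_primitive (hint z) a A s
  have hUc : ∀ s z, Continuous (U s z) := fun s z => continuousOn_univ.1 (hU s z).continuousOn
  let T : ℝ → C(Icc a b, ℝ) → C(Icc a b, ℝ) := fun s z =>
    ⟨fun x => Real.exp (-(k * (x - a))) * U s z x,
      (by fun_prop : Continuous fun x : Icc a b => Real.exp (-(k * ((x : ℝ) - a)))).mul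
        ((hUc s z).comp continuous_subtype_val)⟩
  have hT : ∀ s, ContractingWith (1 / 2) (T s) := fun s => by
    refine ⟨by norm_num, LipschitzWith.of_dist_le_mul fun z w => ?_⟩
    rw [ContinuousMap.dist_le (by positivity)]
    intro x
    have hx := x.2
    have hNd : ∀ y ∈ Ioc a (x : ℝ), ‖(s - N z y) - (s - N w y)‖ ≤
        Real.exp (k * (x - a)) * dist z w * (η / 2 * Q) +
        Real.exp (k * (x - a)) * dist z w * (1 / (4 * k * η)) := fun y hy => by
      have e : (s - N z y) - (s - N w y) = ∫ t in a..y, (h t (E w t) - h t (E z t)) := by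
        rw [intervalIntegral.integral_sub (hint w).intervalIntegrable (hint z).intervalIntegrable]
        ring
      rw [e]
      refine integral_mul_exp_le hk hη hL hy.1.le hy.2 dist_nonneg fun t ht => ?_
      have hLt : 0 ≤ L t := by
        have := (abs_nonneg _).trans (hhL t 1 0)
        simpa using this
      refine (hhL t _ _).trans (mul_le_mul_of_nonneg_left ?_ hLt)
      simp only [E, ← mul_sub, abs_mul, Real.abs_exp]
      refine mul_le_mul_of_nonneg_left ?_ (Real.exp_pos _).le
      rw [← Real.dist_eq, dist_comm]
      exact ContinuousMap.dist_apply_le_dist _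
    have hUd : ‖U s z x - U s w x‖ ≤ Real.exp (k * (x - a)) * (1 / 2 * dist z w) := by
      have e : U s z x - U s w x = ∫ y in a..x, ((s - N z y) - (s - N w y)) := by
        rw [intervalIntegral.integral_sub]
        · simp only [U]; ring
        · exact (continuous_const.sub (hN z)).intervalIntegrable _ _
        · exact (continuous_const.sub (hN w)).intervalIntegrable _ _
      rw [e]
      refine (norm_integral_le_of_norm_le_const fun y hy => hNd y ?_).trans ?_
      · rwa [uIoc_of_le hx.1] at hy
      · rw [abs_of_nonneg (by linarith [hx.1])]
        have h0 : 0 ≤ Real.exp (k * (x - a)) * dist z w := by positivity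
        have h1 : (x : ℝ) - a ≤ b - a := by linarith [hx.2]
        calc _ ≤ (Real.exp (k * (x - a)) * dist z w * (η / 2 * Q) +
              Real.exp (k * (x - a)) * dist z w * (1 / (4 * k * η))) * (b - a) := by gcongr
          _ = Real.exp (k * (x - a)) * dist z w *
              ((b - a) * (η / 2 * Q) + (b - a) * (1 / (4 * k * η))) := by ring
          _ ≤ Real.exp (k * (x - a)) * dist z w * (1 / 4 + 1 / 4) := by gcongr
          _ = _ := by ring
    simp only [T, ContinuousMap.coe_mk, Real.dist_eq, ← mul_sub, abs_mul, Real.abs_exp]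
    calc _ ≤ Real.exp (-(k * (x - a))) * (Real.exp (k * (x - a)) * (1 / 2 * dist z w)) := by
          gcongr; exact hUd
      _ = _ := by rw [← mul_assoc, ← Real.exp_add]; simp
  have hTs : ∀ s s' z, dist (T s z) (T s' z) ≤ |s - s'| * (b - a) := fun s s' z => by
    rw [ContinuousMap.dist_le (by positivity)]
    intro x
    have hx := x.2
    have e : U s z x - U s' z x = (s - s') * (x - a) := by
      simp only [U]
      rw [add_sub_add_left_eq_sub, ← intervalIntegral.integral_sub]
      · simp; ring
      · exact (continuous_const.sub (hN z)).intervalIntegrable _ _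
      · exact (continuous_const.sub (hN z)).intervalIntegrable _ _
    simp only [T, ContinuousMap.coe_mk, Real.dist_eq, ← mul_sub, abs_mul, Real.abs_exp, e]
    have h1 : Real.exp (-(k * (x - a))) ≤ 1 := Real.exp_le_one_iff.2 (by nlinarith [hx.1])
    have h2 : |(x : ℝ) - a| ≤ b - a := by rw [abs_of_nonneg] <;> linarith [hx.1, hx.2]
    calc _ ≤ 1 * (|s - s'| * (b - a)) := by gcongr
      _ = _ := one_mul _
  let Z : ℝ → C(Icc a b, ℝ) := fun s => ContractingWith.fixedPoint (T s) (hT s)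
  have hZ : ∀ s, T s (Z s) = Z s := fun s => (hT s).fixedPoint_isFixedPt
  have hZl : Continuous Z := by
    have : LipschitzWith (2 * (b - a)).toNNReal Z := LipschitzWith.of_dist_le_mul fun s s' => by
      have := (hT s).fixedPoint_lipschitz_in_map (hT s') (C := |s - s'| * (b - a))
        fun z => hTs s s' z
      refine this.trans (le_of_eq ?_)
      rw [Real.coe_toNNReal _ (by positivity), Real.dist_eq]
      norm_num; ring
    exact this.continuous
  have hUZ : ∀ s, ∀ x ∈ Icc a b, E (Z s) x = U s (Z s) x := fun s x hx => by
    have h1 : Real.exp (-(k * (x - a))) * U s (Z s) x = Z s ⟨x, hx⟩ := by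
      conv_rhs => rw [← hZ s]
      rfl
    simp only [E, IccExtend_of_mem _ _ hx, ← h1]
    rw [← mul_assoc, ← Real.exp_add]; simp
  have hFc : Continuous fun s => U s (Z s) b := by
    have : (fun s => U s (Z s) b) = fun s => Real.exp (k * (b - a)) * Z s ⟨b, hab.le, le_rfl⟩ := by
      ext s
      rw [← hUZ s b ⟨hab.le, le_rfl⟩]
      simp only [E, IccExtend_of_mem hab.le _ (⟨hab.le, le_rfl⟩ : b ∈ Icc a b)]
    rw [this]
    exact continuous_const.mul ((continuous_eval_const _).comp hZl)
  set R := ∫ t, H t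
  have hH0 : ∀ t, 0 ≤ H t := fun t => (abs_nonneg _).trans (hhH t 0)
  have hR : ∀ s z, |U s z b - (A + s * (b - a))| ≤ R * (b - a) := fun s z => by
    have e : U s z b - (A + s * (b - a)) = - ∫ y in a..b, N z y := by
      simp only [U]
      rw [intervalIntegral.integral_sub intervalIntegrable_const ((hN z).intervalIntegrable _ _)]
      simp; ring
    rw [e, abs_neg, ← Real.norm_eq_abs]
    refine (intervalIntegral.norm_integral_le_of_norm_le_const (C := R) fun y hy => ?_).trans (le_of_eq ?_)
    · rw [uIoc_of_le hab.le] at hy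
      refine (norm_integral_le_of_norm_le hy.1.le (ae_of_all _ fun t _ => hhH t _)
        hH.intervalIntegrable).trans ?_
      rw [integral_of_le hy.1.le]
      exact setIntegral_le_integral hH (Eventually.of_forall hH0)
    · rw [abs_of_pos hba]
  have hRn : 0 ≤ R := integral_nonneg hH0
  -- The endpoint value is continuous in the slope `s` and differs from `A + s (b - a)` by at most
  -- `R (b - a)`; slopes `R` below and above `(B - A) / (b - a)` therefore bracket `B`.
  obtain ⟨s, -, hs⟩ := intermediate_value_Icc
    (show (B - A) / (b - a) - R ≤ (B - A) / (b - a) + R by linarith) hFc.continuousOn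
    (show B ∈ Icc _ _ by
      constructor
      · have := (abs_le.1 (hR ((B - A) / (b - a) - R) (Z ((B - A) / (b - a) - R)))).2
        have e : ((B - A) / (b - a) - R) * (b - a) = (B - A) - R * (b - a) := by field_simp
        linarith
      · have := (abs_le.1 (hR ((B - A) / (b - a) + R) (Z ((B - A) / (b - a) + R)))).1
        have e : ((B - A) / (b - a) + R) * (b - a) = (B - A) + R * (b - a) := by field_simp
        linarith)
  exact ⟨_, _, _, hU s (Z s), fun t ht => by simp only [hUZ s t ht], by simp [U], hs⟩

/-! ### The linear problem -/

theorem exists_solvesOn_zero_boundary {a b : ℝ} (hab : a < b) {g : ℝ → ℝ} (hg : Integrable g) :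
    ∃ u p, SolvesOn univ u p g ∧ u a = 0 ∧ u b = 0 := by
  set s := (∫ y in a..b, ∫ t in a..y, g t) / (b - a)
  refine ⟨_, _, solvesOn_primitive hg a 0 s, by simp, ?_⟩
  have hc : Continuous fun y => ∫ t in a..y, g t :=
    intervalIntegral.continuous_primitive (fun _ _ => hg.intervalIntegrable) a
  rw [intervalIntegral.integral_sub intervalIntegrable_const (hc.intervalIntegrable _ _)]
  have : b - a ≠ 0 := (sub_pos.2 hab).ne'
  simp only [intervalIntegral.integral_const, smul_eq_mul, s]
  field_simp
  ring

/-- `(b - a)` times the Green potential of `h`. -/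
noncomputable def green (a b : ℝ) (h : ℝ → ℝ) (x : ℝ) : ℝ :=
  (b - x) * (∫ t in a..x, (t - a) * h t) + (x - a) * ∫ t in x..b, (b - t) * h t

/-- In the combination of the two moment identities the terms containing `p x` cancel. -/
theorem SolvesOn.green_eq {a b x : ℝ} {u p g : ℝ → ℝ} (hu : SolvesOn (Icc a b) u p g)
    (ha : u a = 0) (hb : u b = 0) (hx : x ∈ Icc a b) : green a b g x = (b - a) * u x := by
  have hab := hx.1.trans hx.2
  have h1 := hu.integral_sub_mul ordConnected_Icc (left_mem_Icc.2 hab) hx a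
  have h2 := hu.integral_sub_mul ordConnected_Icc hx (right_mem_Icc.2 hab) b
  have h3 : ∫ t in x..b, (b - t) * g t = -∫ t in x..b, (t - b) * g t := by
    rw [← intervalIntegral.integral_neg]; congr 1; ext t; ring
  rw [green, h3, h1, h2, ha, hb]
  ring

section Bounds

variable {a b x : ℝ} {h k : ℝ → ℝ}

theorem intervalIntegrable_continuous_mul (hi : Integrable h) {w : ℝ → ℝ} (hw : Continuous w)
    (x y : ℝ) : IntervalIntegrable (fun t => w t * h t) volume x y :=
  hi.intervalIntegrable.continuousOn_mul hw.continuousOn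

theorem green_sub (hh : Integrable h) (hk : Integrable k) :
    green a b (fun t => h t - k t) x = green a b h x - green a b k x := by
  simp only [green, mul_sub]
  have h1 := fun (y z : ℝ) => intervalIntegrable_continuous_mul hh (w := fun t => t - a)
    (by fun_prop) y z
  have h2 := fun (y z : ℝ) => intervalIntegrable_continuous_mul hk (w := fun t => t - a)
    (by fun_prop) y z
  have h3 := fun (y z : ℝ) => intervalIntegrable_continuous_mul hh (w := fun t => b - t)
    (by fun_prop) y z
  have h4 := fun (y z : ℝ) => intervalIntegrable_continuous_mul hk (w := fun t => b - t)
    (by fun_prop) y z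
  rw [intervalIntegral.integral_sub (h1 _ _) (h2 _ _),
    intervalIntegral.integral_sub (h3 _ _) (h4 _ _)]
  ring

/-- The kernel is `(b - x)(t - a)` for `t ≤ x` and `(x - a)(b - t)` for `t ≥ x`; in each case its
factors dominate `δ(x)` and `δ(t)` in some order. -/
theorem mul_integral_le_green (hh : Integrable h) (h0 : ∀ t, 0 ≤ h t) (hx : x ∈ Icc a b) :
    min (x - a) (b - x) * ∫ t in a..b, min (t - a) (b - t) * h t ≤ green a b h x := by
  have h1 := fun (y z : ℝ) => intervalIntegrable_continuous_mul hh
    (w := fun t => min (t - a) (b - t)) (by fun_prop) y z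
  have h2 := fun (y z : ℝ) => intervalIntegrable_continuous_mul hh (w := fun t => t - a)
    (by fun_prop) y z
  have h3 := fun (y z : ℝ) => intervalIntegrable_continuous_mul hh (w := fun t => b - t)
    (by fun_prop) y z
  rw [← integral_add_adjacent_intervals (h1 a x) (h1 x b), mul_add, green,
    ← intervalIntegral.integral_const_mul, ← intervalIntegral.integral_const_mul,
    ← intervalIntegral.integral_const_mul, ← intervalIntegral.integral_const_mul]
  refine add_le_add (integral_mono_on hx.1 ((h1 _ _).const_mul _) ((h2 _ _).const_mul _)
    fun t ht => ?_) (integral_mono_on hx.2 ((h1 _ _).const_mul _) ((h3 _ _).const_mul _)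
    fun t ht => ?_)
  · have := h0 t
    have e1 : 0 ≤ min (t - a) (b - t) := le_min (by linarith [ht.1]) (by linarith [ht.2, hx.2])
    have e2 : 0 ≤ b - x := by linarith [hx.2]
    gcongr
    · exact min_le_right _ _
    · exact min_le_left _ _
  · have := h0 t
    have e1 : 0 ≤ min (t - a) (b - t) := le_min (by linarith [ht.1, hx.1]) (by linarith [ht.2])
    have e2 : 0 ≤ x - a := by linarith [hx.1]
    gcongr
    · exact min_le_left _ _
    · exact min_le_right _ _

/-- If `x` is nearer to `a`, then `(b - x)(t - a) ≤ (x - a)(b - t)` for `t ≤ x`, the difference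
being `(x - t)(b - a)`. The whole kernel is then at most `(x - a)(b - t)`; the other half is
symmetric. -/
theorem green_le_mul_max (hh : Integrable h) (h0 : ∀ t, 0 ≤ h t) (hx : x ∈ Icc a b) :
    green a b h x ≤ min (x - a) (b - x) *
      max (∫ t in a..b, (t - a) * h t) (∫ t in a..b, (b - t) * h t) := by
  have h2 := fun (y z : ℝ) => intervalIntegrable_continuous_mul hh (w := fun t => t - a)
    (by fun_prop) y z
  have h3 := fun (y z : ℝ) => intervalIntegrable_continuous_mul hh (w := fun t => b - t)
    (by fun_prop) y z
  have hxa : 0 ≤ x - a := by linarith [hx.1]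
  have hxb : 0 ≤ b - x := by linarith [hx.2]
  rcases le_total (x - a) (b - x) with hle | hle
  · rw [min_eq_left hle]
    refine le_trans ?_ (mul_le_mul_of_nonneg_left (le_max_right _ _) hxa)
    rw [← integral_add_adjacent_intervals (h3 a x) (h3 x b), mul_add, green]
    refine add_le_add ?_ le_rfl
    rw [← intervalIntegral.integral_const_mul, ← intervalIntegral.integral_const_mul]
    refine integral_mono_on hx.1 ((h2 _ _).const_mul _) ((h3 _ _).const_mul _) fun t ht => ?_
    rw [← mul_assoc, ← mul_assoc]
    exact mul_le_mul_of_nonneg_right (by nlinarith [ht.2, hx.1, hx.2]) (h0 t)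
  · rw [min_eq_right hle]
    refine le_trans ?_ (mul_le_mul_of_nonneg_left (le_max_left _ _) hxb)
    rw [← integral_add_adjacent_intervals (h2 a x) (h2 x b), mul_add, green]
    refine add_le_add le_rfl ?_
    rw [← intervalIntegral.integral_const_mul, ← intervalIntegral.integral_const_mul]
    refine integral_mono_on hx.2 ((h3 _ _).const_mul _) ((h2 _ _).const_mul _) fun t ht => ?_
    rw [← mul_assoc, ← mul_assoc]
    exact mul_le_mul_of_nonneg_right (by nlinarith [ht.1, hx.1, hx.2]) (h0 t)

theorem integral_min_mul_le (hab : a ≤ b) (hh : Integrable h) (h0 : ∀ t, 0 ≤ h t) :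
    ∫ t in a..b, min (t - a) (b - t) * h t ≤ ∫ t in a..b, (t - a) * h t :=
  integral_mono_on hab (intervalIntegrable_continuous_mul hh (by fun_prop) a b)
    (intervalIntegrable_continuous_mul hh (by fun_prop) a b)
    fun t _ => mul_le_mul_of_nonneg_right (min_le_left _ _) (h0 t)

end Bounds

/-! ### Regularized problems -/

theorem abs_max_rpow_sub_max_rpow_le {τ α : ℝ} (hτ : 0 < τ) (hα : 0 < α) (ξ ζ : ℝ) :
    |max ξ τ ^ (-α) - max ζ τ ^ (-α)| ≤ α * τ ^ (-α - 1) * |ξ - ζ| := by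
  have h1 : ∀ x ∈ Ici τ, HasDerivWithinAt (fun x : ℝ => x ^ (-α)) (-α * x ^ (-α - 1)) (Ici τ) x :=
    fun x hx => (Real.hasDerivAt_rpow_const (Or.inl (hτ.trans_le hx).ne')).hasDerivWithinAt
  have h2 : ∀ x ∈ Ici τ, ‖-α * x ^ (-α - 1)‖ ≤ α * τ ^ (-α - 1) := fun x hx => by
    have hx0 := hτ.trans_le hx
    rw [norm_mul, Real.norm_eq_abs, Real.norm_eq_abs, abs_neg, abs_of_pos hα,
      abs_of_nonneg (Real.rpow_nonneg hx0.le _)]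
    exact mul_le_mul_of_nonneg_left (Real.rpow_le_rpow_of_nonpos hτ hx (by linarith)) hα.le
  have h3 := (convex_Ici τ).norm_image_sub_le_of_norm_hasDerivWithin_le h1 h2
    (le_max_right ζ τ) (le_max_right ξ τ)
  rw [Real.norm_eq_abs, Real.norm_eq_abs] at h3
  exact h3.trans (mul_le_mul_of_nonneg_left (abs_max_sub_max_le_abs _ _ _) (by positivity))

theorem max_rpow_neg_le {τ α ξ : ℝ} (hτ : 0 < τ) (hα : 0 < α) :
    max ξ τ ^ (-α) ≤ τ ^ (-α) :=
  Real.rpow_le_rpow_of_nonpos hτ (le_max_right _ _) (by linarith)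

section Regularized

variable {a b α γ lam τ ε m : ℝ} {K M v q : ℝ → ℝ}

/-- With a subsolution `v` at hand, the problem with boundary values `τ` has a solution above
`max v τ`. -/
theorem exists_regularized (hab : a < b) (hα : 0 < α) (hγ : 0 < γ) (hlam : 0 < lam)
    (hK0 : ∀ x, 0 ≤ K x) (hM0 : ∀ x, 0 ≤ M x) (hK1 : Integrable K) (hM1 : Integrable M)
    (hK2 : MemLp K 2) (hM2 : MemLp M 2)
    (hv : SolvesOn univ v q (fun x => ε * (K x - M x))) (hva : v a = 0) (hvb : v b = 0)
    (hvε : ∀ x ∈ Ioo a b, ε ≤ v x ^ (-α)) (hm : 0 < m) (hvm : ∀ x ∈ Ioo a b, 0 < M x → m ≤ v x)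
    (hlm : lam * m ^ (-γ) ≤ ε) (hτ : 0 < τ) (hτm : τ ≤ m) (hτε : ε ≤ τ ^ (-α)) :
    ∃ U P, SolvesOn (Icc a b) U P (fun x => rhs α γ lam K M x (U x)) ∧ U a = τ ∧ U b = τ ∧
      ∀ x ∈ Icc a b, v x ≤ U x ∧ τ ≤ U x := by
  -- The absorption term is truncated at `m`, not at `τ`: its coefficient `lam * max ξ m ^ (-γ)`
  -- then never exceeds `ε`, which is what the comparison with `v` needs.
  set h : ℝ → ℝ → ℝ := fun t ξ => K t * max ξ τ ^ (-α) - lam * M t * max ξ m ^ (-γ) with hh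
  have hc : ∀ {s β : ℝ} {u : ℝ → ℝ}, 0 < s → Continuous u →
      Continuous fun t => max (u t) s ^ (-β) := fun {s β u} hs hu =>
    (hu.max continuous_const).rpow_const fun t => Or.inl (hs.trans_le (le_max_right _ _)).ne'
  have hpn : ∀ {s β ξ : ℝ}, 0 < s → 0 ≤ max ξ s ^ (-β) := fun {s β ξ} hs =>
    Real.rpow_nonneg (hs.le.trans (le_max_right _ _)) _
  obtain ⟨U, P, g, hU, hg, hUa, hUb⟩ := exists_solvesOn_boundary hab (h := h)
    (H := fun t => K t * τ ^ (-α) + lam * M t * m ^ (-γ))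
    (L := fun t => (α * τ ^ (-α - 1)) * K t + (lam * (γ * m ^ (-γ - 1))) * M t)
    (fun u hu => (hK1.1.mul (hc hτ hu).aestronglyMeasurable).sub
      ((hM1.1.const_mul lam).mul (hc hm hu).aestronglyMeasurable))
    ((hK1.mul_const _).add ((hM1.const_mul _).mul_const _))
    (fun t ξ => by
      have h1 := mul_le_mul_of_nonneg_left (max_rpow_neg_le (ξ := ξ) hτ hα) (hK0 t)
      have h2 := mul_le_mul_of_nonneg_left (max_rpow_neg_le (ξ := ξ) hm hγ)
        (mul_nonneg hlam.le (hM0 t))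
      have h3 := mul_nonneg (hK0 t) (hpn (β := α) (ξ := ξ) hτ)
      have h4 := mul_nonneg (mul_nonneg hlam.le (hM0 t)) (hpn (β := γ) (ξ := ξ) hm)
      rw [abs_le]; constructor <;> simp only [hh] <;> linarith)
    ((hK2.const_mul _).add (hM2.const_mul _)).integrable_sq
    (fun t ξ ζ => by
      have h1 := mul_le_mul_of_nonneg_left (abs_max_rpow_sub_max_rpow_le hτ hα ξ ζ) (hK0 t)
      have h2 := mul_le_mul_of_nonneg_left (abs_max_rpow_sub_max_rpow_le hm hγ ξ ζ)
        (mul_nonneg hlam.le (hM0 t))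
      have e : h t ξ - h t ζ = K t * (max ξ τ ^ (-α) - max ζ τ ^ (-α)) -
          lam * M t * (max ξ m ^ (-γ) - max ζ m ^ (-γ)) := by simp only [hh]; ring
      rw [e]
      refine (abs_sub _ _).trans ?_
      rw [abs_mul, abs_of_nonneg (hK0 t), abs_mul (lam * M t),
        abs_of_nonneg (mul_nonneg hlam.le (hM0 t))]
      linarith) τ τ
  have hU' : SolvesOn (Icc a b) U P (fun t => h t (U t)) :=
    (hU.mono (subset_univ _)).congr_ae ordConnected_Icc (ae_of_all _ hg)
  have hvU : ∀ x ∈ Icc a b, v x ≤ U x := by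
    refine (hv.mono (subset_univ _)).le_of_le hU' (by rw [hva, hUa]; exact hτ.le)
      (by rw [hvb, hUb]; exact hτ.le) (ae_of_all _ fun t ht hlt => ?_)
    have h1 : ε ≤ max (U t) τ ^ (-α) := by
      have : max (v t) τ ^ (-α) ≤ max (U t) τ ^ (-α) :=
        Real.rpow_le_rpow_of_nonpos (hτ.trans_le (le_max_right _ _))
          (max_le_max hlt.le le_rfl) (by linarith)
      refine le_trans ?_ this
      rcases max_choice (v t) τ with e | e <;> rw [e]
      exacts [hvε t ht, hτε]
    have h2 : lam * max (U t) m ^ (-γ) ≤ ε :=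
      (mul_le_mul_of_nonneg_left (max_rpow_neg_le hm hγ) hlam.le).trans hlm
    have := mul_le_mul_of_nonneg_left h1 (hK0 t)
    have := mul_le_mul_of_nonneg_left h2 (hM0 t)
    simp only [hh]
    linarith
  -- Where `U < τ`, the coefficient `M` vanishes, since `M > 0` would force `U ≥ v ≥ m ≥ τ`. There
  -- the right-hand side is nonnegative and the constant `τ` is a lower barrier.
  have hτU : ∀ x ∈ Icc a b, τ ≤ U x := by
    refine (SolvesOn.const τ).le_of_le hU' hUa.ge hUb.ge (ae_of_all _ fun t ht hlt => ?_)
    have : M t = 0 := by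
      by_contra hne
      have h1 := hvm t ht (lt_of_le_of_ne (hM0 t) (Ne.symm hne))
      linarith [hvU t (Ioo_subset_Icc_self ht)]
    simp only [hh, this]
    have := mul_nonneg (hK0 t) (hpn (β := α) (ξ := U t) hτ)
    linarith
  refine ⟨U, P, hU'.congr_ae ordConnected_Icc ?_, hUa, hUb, fun x hx => ⟨hvU x hx, hτU x hx⟩⟩
  -- The bound `m ≤ v` on `{M > 0}` is available only in the open interval, so the endpoints are
  -- discarded.
  have hne : ∀ᵐ t : ℝ, t ≠ a ∧ t ≠ b := by
    have h1 : ∀ᵐ t : ℝ, t ≠ a := by simp [ae_iff, measure_singleton]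
    have h2 : ∀ᵐ t : ℝ, t ≠ b := by simp [ae_iff, measure_singleton]
    filter_upwards [h1, h2] with t a b using ⟨a, b⟩
  filter_upwards [hne] with t hn ht
  simp only [hh, rhs, max_eq_left (hτU t ht)]
  rcases (hM0 t).eq_or_lt with e | hpos
  · simp [← e]
  · have := hvm t ⟨lt_of_le_of_ne ht.1 hn.1.symm, lt_of_le_of_ne ht.2 hn.2⟩ hpos
    rw [max_eq_left (this.trans (hvU t ht))]

/-- Wherever `U` exceeds the barrier it exceeds `η`, so its source is at most `η^(-α) K`. The bound
holds for every `η` above the boundary values, hence uniformly in small `τ`; letting `η` be small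
later gives continuity at the boundary. -/
theorem SolvesOn.le_add_rpow_mul {U P w r : ℝ → ℝ} {η : ℝ} (hα : 0 < α) (hlam : 0 < lam)
    (hK0 : ∀ x, 0 ≤ K x) (hM0 : ∀ x, 0 ≤ M x)
    (hU : SolvesOn (Icc a b) U P (fun x => rhs α γ lam K M x (U x)))
    (hη : 0 < η) (hUa : U a ≤ η) (hUb : U b ≤ η) (hw : SolvesOn (Icc a b) w r K) (hwa : w a = 0)
    (hwb : w b = 0) : ∀ x ∈ Icc a b, U x ≤ η + η ^ (-α) * w x := by
  refine hU.le_of_le ((SolvesOn.const η).add (hw.const_mul (η ^ (-α)))) (by simpa [hwa])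
    (by simpa [hwb]) (ae_of_all _ fun t ht hlt => ?_)
  have hw0 : 0 ≤ w t := by
    have := (SolvesOn.const 0).le_of_le hw hwa.ge hwb.ge (ae_of_all _ fun s _ _ => hK0 s)
    exact this t (Ioo_subset_Icc_self ht)
  have hηU : η ≤ U t := by
    have : 0 ≤ η ^ (-α) * w t := by positivity
    linarith
  have h1 := mul_le_mul_of_nonneg_left
    (Real.rpow_le_rpow_of_nonpos hη hηU (by linarith : -α ≤ 0)) (hK0 t)
  have h2 : 0 ≤ lam * M t * U t ^ (-γ) :=
    mul_nonneg (mul_nonneg hlam.le (hM0 t)) (Real.rpow_nonneg (hη.le.trans hηU) _)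
  simp only [rhs]
  linarith

end Regularized

/-! ### Compactness of bounded families of solutions. -/

/-- A bounded, locally equi-Lipschitz sequence on an open interval has a pointwise convergent
subsequence. -/
theorem exists_subseq_tendsto_of_lipschitz {a b C : ℝ} {f : ℕ → ℝ → ℝ}
    (hC : ∀ n, ∀ x ∈ Ioo a b, |f n x| ≤ C)
    (hL : ∀ c ∈ Ioo a b, ∀ e ∈ Ioo a b, ∃ L, ∀ n, ∀ x ∈ Icc c e, ∀ y ∈ Icc c e,
      |f n x - f n y| ≤ L * |x - y|) :
    ∃ φ : ℕ → ℕ, StrictMono φ ∧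
      ∀ x ∈ Ioo a b, ∃ l, Tendsto (fun n => f (φ n) x) atTop (𝓝 l) := by
  classical
  -- Restriction to the rationals places the sequence in a countable product of compact intervals;
  -- equicontinuity then carries convergence to every real point.
  let F : ℕ → ℚ → ℝ := fun n r => if (r : ℝ) ∈ Ioo a b then f n r else 0
  have hF : ∀ n, F n ∈ Set.pi univ fun _ : ℚ => Icc (-|C|) |C| := fun n r _ => by
    refine abs_le.1 ?_
    simp only [F]
    split_ifs with hr
    · exact (hC n r hr).trans (le_abs_self C)
    · simp
  obtain ⟨F', -, φ, hφ, hlim⟩ := (isCompact_univ_pi fun _ => isCompact_Icc).tendsto_subseq hF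
  refine ⟨φ, hφ, fun x hx => cauchySeq_tendsto_of_complete ?_⟩
  obtain ⟨c, hac, hcx⟩ := exists_between hx.1
  obtain ⟨e, hxe, heb⟩ := exists_between hx.2
  obtain ⟨L, hL⟩ := hL c ⟨hac, hcx.trans hx.2⟩ e ⟨hx.1.trans hxe, heb⟩
  rw [Metric.cauchySeq_iff']
  intro ε hε
  set δ := min (e - x) (ε / (4 * (|L| + 1)))
  have hδ : 0 < δ := lt_min (by linarith) (by positivity)
  obtain ⟨r, hr1, hr2⟩ := exists_rat_btwn (show x < x + δ by linarith)
  have hre : (r : ℝ) ≤ e := by linarith [min_le_left (e - x) (ε / (4 * (|L| + 1)))]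
  have hrI : (r : ℝ) ∈ Ioo a b := ⟨hx.1.trans hr1, hre.trans_lt heb⟩
  have hxr : ∀ n, |f n x - f n r| ≤ ε / 4 := fun n => by
    refine (hL n x ⟨hcx.le, hxe.le⟩ r ⟨hcx.le.trans hr1.le, hre⟩).trans ?_
    have h1 : |x - r| ≤ ε / (4 * (|L| + 1)) := by
      rw [abs_sub_comm, abs_of_pos (by linarith)]
      linarith [min_le_right (e - x) (ε / (4 * (|L| + 1)))]
    calc L * |x - r| ≤ (|L| + 1) * (ε / (4 * (|L| + 1))) := by
          gcongr
          linarith [le_abs_self L]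
      _ = ε / 4 := by field_simp
  have hcr : CauchySeq fun n => f (φ n) r := by
    have := (tendsto_pi_nhds.1 hlim r).cauchySeq
    simpa [F, hrI.1, hrI.2] using this
  obtain ⟨N, hN⟩ := Metric.cauchySeq_iff'.1 hcr (ε / 4) (by positivity)
  refine ⟨N, fun n hn => ?_⟩
  have h1 := hN n hn
  have h2 := hxr (φ n)
  have h3 := hxr (φ N)
  rw [Real.dist_eq] at h1 ⊢
  rw [abs_le] at h2 h3
  rw [abs_lt] at h1 ⊢
  constructor <;> linarith

section Limit

variable {a b C : ℝ} {U P g : ℕ → ℝ → ℝ} {H : ℝ → ℝ}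

/-- The mean value theorem provides a point where the slope is at most `2C / (e - c)`; integrating
the dominated right-hand side controls the slope elsewhere. -/
theorem exists_deriv_bound (hU : ∀ n, SolvesOn (Ioo a b) (U n) (P n) (g n))
    (hC : ∀ n, ∀ x ∈ Ioo a b, |U n x| ≤ C)
    (hH : ∀ x ∈ Ioo a b, ∀ y ∈ Ioo a b, IntervalIntegrable H volume x y)
    (hgH : ∀ n, ∀ t ∈ Ioo a b, |g n t| ≤ H t) {c e : ℝ} (hc : c ∈ Ioo a b) (he : e ∈ Ioo a b)
    (hce : c < e) : ∃ L, ∀ n, ∀ x ∈ Icc c e, |P n x| ≤ L := by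
  have hsub : Icc c e ⊆ Ioo a b := Icc_subset_Ioo hc.1 he.2
  have hHi : IntegrableOn H (Ioc c e) := (intervalIntegrable_iff_integrableOn_Ioc_of_le hce.le).1
    (hH c hc e he)
  refine ⟨2 * C / (e - c) + ∫ t in Ioc c e, H t, fun n x hx => ?_⟩
  obtain ⟨ξ, hξ, hslope⟩ := exists_hasDerivAt_eq_slope (U n) (P n) hce
    ((hU n).continuousOn.mono hsub) fun y hy => (hU n).1 y (hsub (Ioo_subset_Icc_self hy))
  have h1 : |P n ξ| ≤ 2 * C / (e - c) := by
    rw [hslope, abs_div, abs_of_pos (sub_pos.2 hce)]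
    have h2 := hC n c hc
    have h3 := hC n e he
    have : |U n e - U n c| ≤ 2 * C := (abs_sub _ _).trans (by linarith)
    have := sub_pos.2 hce
    gcongr
  have hξ' := Ioo_subset_Icc_self hξ
  have hss : Ι ξ x ⊆ Ioc c e := by
    rw [uIoc]
    exact Ioc_subset_Ioc (le_min hξ'.1 hx.1) (max_le hξ'.2 hx.2)
  have h2 : |∫ t in ξ..x, g n t| ≤ ∫ t in Ioc c e, H t := by
    refine (norm_integral_le_integral_norm_uIoc (f := g n)).trans ?_
    have hH0 : 0 ≤ᵐ[volume.restrict (Ioc c e)] H :=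
      (ae_restrict_iff' measurableSet_Ioc).2 (ae_of_all _ fun t ht =>
        (abs_nonneg _).trans (hgH n t (hsub (Ioc_subset_Icc_self ht))))
    refine le_trans ?_ (setIntegral_mono_set hHi hH0 (ae_of_all _ hss))
    refine setIntegral_mono_on (intervalIntegrable_iff.1 ((hU n).2 ξ (hsub hξ') x (hsub hx))).norm
      (hHi.mono_set hss) measurableSet_uIoc fun t ht => hgH n t
        (hsub (Ioc_subset_Icc_self (hss ht)))
  have h3 := (hU n).3 ξ (hsub hξ') x (hsub hx)
  have h4 : P n x = P n ξ - ∫ t in ξ..x, g n t := by linarith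
  rw [h4]
  exact (abs_sub _ _).trans (add_le_add h1 h2)

/-- Compactness: a bounded sequence of solutions with locally uniformly integrable right-hand sides
subconverges pointwise to a solution. -/
theorem exists_subseq_tendsto_solvesOn {w : ℝ → ℝ} {G : ℝ → ℝ → ℝ} (hab : a < b)
    (hU : ∀ n, SolvesOn (Ioo a b) (U n) (P n) (fun t => G t (U n t)))
    (hC : ∀ n, ∀ x ∈ Ioo a b, |U n x| ≤ C)
    (hw : ∀ x ∈ Ioo a b, 0 < w x) (hwU : ∀ n, ∀ x ∈ Ioo a b, w x ≤ U n x)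
    (hG : ∀ t ∈ Ioo a b, ContinuousOn (G t) (Ioi 0))
    (hH : ∀ x ∈ Ioo a b, ∀ y ∈ Ioo a b, IntervalIntegrable H volume x y)
    (hgH : ∀ n, ∀ t ∈ Ioo a b, |G t (U n t)| ≤ H t) :
    ∃ φ : ℕ → ℕ, ∃ u p, StrictMono φ ∧
      (∀ x ∈ Ioo a b, Tendsto (fun n => U (φ n) x) atTop (𝓝 (u x))) ∧
      SolvesOn (Ioo a b) u p (fun t => G t (u t)) := by
  have hbound : ∀ c ∈ Ioo a b, ∀ e ∈ Ioo a b, c < e → ∃ L, ∀ n, ∀ x ∈ Icc c e, |P n x| ≤ L :=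
    fun c hc e he hce => exists_deriv_bound hU hC hH hgH hc he hce
  have hboundu : ∀ x ∈ Ioo a b, ∀ y ∈ Ioo a b, ∃ L, ∀ n, ∀ t ∈ uIcc x y, |P n t| ≤ L := by
    intro x hx y hy
    obtain ⟨e, he1, he2⟩ := exists_between (max_lt hx.2 hy.2)
    have hmin : min x y ∈ Ioo a b := ⟨lt_min hx.1 hy.1, (min_le_left _ _).trans_lt hx.2⟩
    obtain ⟨L, hL⟩ := hbound (min x y) hmin e ⟨hmin.1.trans_le (min_le_max.trans he1.le), he2⟩
      (min_le_max.trans_lt he1)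
    exact ⟨L, fun n t ht => hL n t ⟨ht.1, ht.2.trans he1.le⟩⟩
  obtain ⟨φ, hφ, hlim⟩ := exists_subseq_tendsto_of_lipschitz hC fun c hc e he => by
    obtain ⟨L, hL⟩ := hboundu c hc e he
    have hss : Icc c e ⊆ Ioo a b := Icc_subset_Ioo hc.1 he.2
    refine ⟨L, fun n x hx y hy => ?_⟩
    exact (convex_Icc c e).norm_image_sub_le_of_norm_hasDerivWithin_le
      (fun t ht => ((hU n).1 t (hss ht)).hasDerivWithinAt)
      (fun t ht => hL n t (Icc_subset_uIcc ht)) hy hx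
  choose! u hu using hlim
  set m := (a + b) / 2
  have hm : m ∈ Ioo a b := ⟨by simp only [m]; linarith, by simp only [m]; linarith⟩
  obtain ⟨Lm, hLm⟩ := hboundu m hm m hm
  -- A second extraction makes the slopes converge at one point; convergence of the integrals of the
  -- right-hand sides then gives it everywhere.
  obtain ⟨p₀, -, ψ, hψ, hp₀⟩ := (isCompact_Icc (a := -Lm) (b := Lm)).tendsto_subseq
    (x := fun n => P (φ n) m) fun n => abs_le.1 (hLm (φ n) m (by simp))
  have hu' : ∀ x ∈ Ioo a b, Tendsto (fun n => U (φ (ψ n)) x) atTop (𝓝 (u x)) := fun x hx =>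
    (hu x hx).comp hψ.tendsto_atTop
  have hss : ∀ x ∈ Ioo a b, ∀ y ∈ Ioo a b, Ι x y ⊆ Ioo a b := fun x hx y hy =>
    uIoc_subset_uIcc.trans (ordConnected_Ioo.uIcc_subset hx hy)
  have hgt : ∀ t ∈ Ioo a b, Tendsto (fun n => G t (U (φ (ψ n)) t)) atTop (𝓝 (G t (u t))) := by
    intro t ht
    have hpos : 0 < u t := (hw t ht).trans_le (ge_of_tendsto' (hu' t ht) fun n => hwU _ t ht)
    -- The positive lower bound `w` keeps the limit away from the singularity of `G t` at `0`.
    exact ((hG t ht).continuousAt (Ioi_mem_nhds hpos)).tendsto.comp (hu' t ht)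
  have hgm : ∀ n, ∀ x ∈ Ioo a b, ∀ y ∈ Ioo a b,
      AEStronglyMeasurable (fun t => G t (U n t)) (volume.restrict (Ι x y)) :=
    fun n x hx y hy => (intervalIntegrable_iff.1 ((hU n).2 x hx y hy)).1
  have hgi : ∀ x ∈ Ioo a b, ∀ y ∈ Ioo a b, IntervalIntegrable (fun t => G t (u t)) volume x y := by
    intro x hx y hy
    rw [intervalIntegrable_iff]
    refine (intervalIntegrable_iff.1 (hH x hx y hy)).mono'
      (aestronglyMeasurable_of_tendsto_ae atTop (fun n => hgm (φ (ψ n)) x hx y hy) ?_) ?_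
    · exact (ae_restrict_iff' measurableSet_uIoc).2
        (ae_of_all _ fun t ht => hgt t (hss x hx y hy ht))
    · refine (ae_restrict_iff' measurableSet_uIoc).2 (ae_of_all _ fun t ht => ?_)
      have ht' := hss x hx y hy ht
      exact le_of_tendsto' (hgt t ht').abs fun n => hgH _ t ht'
  have hgI : ∀ x ∈ Ioo a b, ∀ y ∈ Ioo a b, Tendsto (fun n => ∫ t in x..y, G t (U (φ (ψ n)) t))
      atTop (𝓝 (∫ t in x..y, G t (u t))) := fun x hx y hy =>
    intervalIntegral.tendsto_integral_filter_of_dominated_convergence H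
      (Eventually.of_forall fun n => hgm _ x hx y hy)
      (Eventually.of_forall fun n => ae_of_all _ fun t ht => hgH _ t (hss x hx y hy ht))
      (hH x hx y hy) (ae_of_all _ fun t ht => hgt t (hss x hx y hy ht))
  set p : ℝ → ℝ := fun y => p₀ - ∫ t in m..y, G t (u t) with hp
  have hPp : ∀ y ∈ Ioo a b, Tendsto (fun n => P (φ (ψ n)) y) atTop (𝓝 (p y)) := fun y hy => by
    refine (hp₀.sub (hgI m hm y hy)).congr fun n => ?_
    have := (hU (φ (ψ n))).3 m hm y hy
    simp only [Function.comp]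
    linarith
  have hpsub : ∀ x ∈ Ioo a b, ∀ y ∈ Ioo a b, p y - p x = -∫ t in x..y, G t (u t) := by
    intro x hx y hy
    have := integral_interval_sub_left (hgi m hm y hy) (hgi m hm x hx)
    simp only [hp]
    linarith
  have hpc : ContinuousOn p (Ioo a b) := by
    intro x hx
    obtain ⟨c, hc1, hc2⟩ := exists_between hx.1
    obtain ⟨e, he1, he2⟩ := exists_between hx.2
    have hc : c ∈ Ioo a b := ⟨hc1, hc2.trans hx.2⟩
    have he : e ∈ Ioo a b := ⟨hx.1.trans he1, he2⟩
    have h1 := continuousOn_primitive_interval' (hgi c hc e he) left_mem_uIcc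
    rw [uIcc_of_le (hc2.trans he1).le] at h1
    have h2 : ContinuousAt (fun y => p c - ∫ t in c..y, G t (u t)) x :=
      continuousAt_const.sub (h1.continuousAt (Icc_mem_nhds hc2 he1))
    refine (h2.congr ?_).continuousWithinAt
    filter_upwards [isOpen_Ioo.mem_nhds hx] with y hy
    linarith [hpsub c hc y hy]
  have hpi : ∀ x ∈ Ioo a b, IntervalIntegrable p volume m x := fun x hx =>
    (hpc.mono (ordConnected_Ioo.uIcc_subset hm hx)).intervalIntegrable
  have hup : ∀ x ∈ Ioo a b, u x = u m + ∫ t in m..x, p t := by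
    intro x hx
    obtain ⟨L, hL⟩ := hboundu m hm x hx
    have h1 : Tendsto (fun n => ∫ t in m..x, P (φ (ψ n)) t) atTop (𝓝 (∫ t in m..x, p t)) :=
      intervalIntegral.tendsto_integral_filter_of_dominated_convergence (fun _ => L)
        (Eventually.of_forall fun n => (intervalIntegrable_iff.1
          ((hU (φ (ψ n))).continuousOn_deriv_uIcc ordConnected_Ioo hm hx).intervalIntegrable).1)
        (Eventually.of_forall fun n => ae_of_all _ fun t ht => hL _ t (uIoc_subset_uIcc ht))
        intervalIntegrable_const (ae_of_all _ fun t ht => hPp t (hss m hm x hx ht))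
    have h2 : Tendsto (fun n => ∫ t in m..x, P (φ (ψ n)) t) atTop (𝓝 (u x - u m)) :=
      ((hu' x hx).sub (hu' m hm)).congr fun n =>
        ((hU (φ (ψ n))).integral_deriv ordConnected_Ioo hm hx).symm
    linarith [tendsto_nhds_unique h1 h2]
  refine ⟨φ ∘ ψ, u, p, hφ.comp hψ, hu', fun x hx => ?_, hgi, hpsub⟩
  have h1 := (integral_hasDerivAt_right (hpi x hx)
    (hpc.stronglyMeasurableAtFilter isOpen_Ioo x hx)
    (hpc.continuousAt (isOpen_Ioo.mem_nhds hx))).const_add (u m)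
  refine h1.congr_of_eventuallyEq ?_
  filter_upwards [isOpen_Ioo.mem_nhds hx] with y hy using hup y hy

end Limit

/-! ### Construction of the singular solution. -/

section Existence

variable {a b α γ lam : ℝ} {K M : ℝ → ℝ}

theorem abs_rhs_le {x ξ ζ : ℝ} (hα : 0 < α) (hγ : 0 < γ) (hlam : 0 < lam) (hK : 0 ≤ K x)
    (hM : 0 ≤ M x) (hζ : 0 < ζ) (hle : ζ ≤ ξ) :
    |rhs α γ lam K M x ξ| ≤ K x * ζ ^ (-α) + lam * M x * ζ ^ (-γ) := by
  have h1 := mul_le_mul_of_nonneg_left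
    (Real.rpow_le_rpow_of_nonpos hζ hle (by linarith : -α ≤ 0)) hK
  have h2 := mul_le_mul_of_nonneg_left
    (Real.rpow_le_rpow_of_nonpos hζ hle (by linarith : -γ ≤ 0)) (mul_nonneg hlam.le hM)
  have h3 := mul_nonneg hK (Real.rpow_nonneg (hζ.le.trans hle) (-α))
  have h4 := mul_nonneg (mul_nonneg hlam.le hM) (Real.rpow_nonneg (hζ.le.trans hle) (-γ))
  rw [abs_le]
  constructor <;> simp only [rhs] <;> linarith

/-- Existence for nonnegative data, in integrated form, with a Hopf type lower bound. -/
theorem exists_solvesOn_rhs (hab : a < b) (hα : 0 < α) (hγ : 0 < γ) (hlam : 0 < lam)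
    (hK0 : ∀ x, 0 ≤ K x) (hM0 : ∀ x, 0 ≤ M x) (hK1 : Integrable K) (hM1 : Integrable M)
    (hK2 : MemLp K 2) (hM2 : MemLp M 2) {A D d : ℝ}
    (hA : A = (∫ t in a..b, min (t - a) (b - t) * K t) -
      max (∫ t in a..b, (t - a) * M t) (∫ t in a..b, (b - t) * M t))
    (hD : D = 1 / 2 * (max (∫ t in a..b, (t - a) * K t) (∫ t in a..b, (b - t) * K t) -
      ∫ t in a..b, min (t - a) (b - t) * M t))
    (hA0 : 0 < A) (hd : 0 < d) (hdM : ∀ x ∈ Ioo a b, 0 < M x → d ≤ min (x - a) (b - x))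
    (hle : lam ≤ (d / (b - a)) ^ γ * (A ^ γ / D ^ (α * ((1 + γ) / (1 + α))))) :
    ∃ u p c, 0 < c ∧ ContinuousOn u (Icc a b) ∧ u a = 0 ∧ u b = 0 ∧
      (∀ x ∈ Icc a b, c * min (x - a) (b - x) ≤ u x) ∧
      SolvesOn (Ioo a b) u p (fun x => rhs α γ lam K M x (u x)) := by
  have hba : 0 < b - a := sub_pos.2 hab
  obtain ⟨φ, q, hφ, hφa, hφb⟩ := exists_solvesOn_zero_boundary hab (hK1.sub hM1)
  have hgr : ∀ x ∈ Icc a b, green a b K x - green a b M x = (b - a) * φ x := fun x hx => by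
    rw [← green_sub hK1 hM1]
    exact (hφ.mono (subset_univ _)).green_eq hφa hφb hx
  have hmin0 : ∀ x ∈ Icc a b, 0 ≤ min (x - a) (b - x) := fun x hx =>
    le_min (by linarith [hx.1]) (by linarith [hx.2])
  have hminpos : ∀ x ∈ Ioo a b, 0 < min (x - a) (b - x) := fun x hx =>
    lt_min (by linarith [hx.1]) (by linarith [hx.2])
  have hφlow : ∀ x ∈ Icc a b, A / (b - a) * min (x - a) (b - x) ≤ φ x := fun x hx => by
    have h1 := mul_integral_le_green hK1 hK0 hx
    have h2 := green_le_mul_max hM1 hM0 hx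
    have h3 : A * min (x - a) (b - x) ≤ (b - a) * φ x := by
      rw [← hgr x hx, hA]
      linarith
    rw [div_mul_eq_mul_div, div_le_iff₀ hba]
    linarith
  have hφup : ∀ x ∈ Icc a b, (b - a) * φ x ≤ min (x - a) (b - x) * (D * 2) := fun x hx => by
    have h1 := mul_integral_le_green hM1 hM0 hx
    have h2 := green_le_mul_max hK1 hK0 hx
    rw [← hgr x hx, hD]
    linarith
  -- Since `∫ δ h` is at most either one-sided moment, `2D ≥ A > 0`.
  have hD0 : 0 < D := by
    have h1 := integral_min_mul_le hab.le hK1 hK0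
    have h2 := integral_min_mul_le hab.le hM1 hM0
    have h3 := le_max_left (∫ t in a..b, (t - a) * K t) (∫ t in a..b, (b - t) * K t)
    have h4 := le_max_left (∫ t in a..b, (t - a) * M t) (∫ t in a..b, (b - t) * M t)
    linarith
  have hφD : ∀ x ∈ Icc a b, φ x ≤ D := fun x hx => by
    have h1 : min (x - a) (b - x) ≤ (b - a) / 2 := by
      rcases le_total (x - a) (b - x) with h | h
      · rw [min_eq_left h]; linarith
      · rw [min_eq_right h]; linarith
    have h2 := mul_le_mul_of_nonneg_right h1 (show 0 ≤ D * 2 by positivity)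
    exact le_of_mul_le_mul_left (by linarith [hφup x hx]) hba
  -- This solves `(ε D)^(-α) = ε`, making `ε φ ≤ ε D` imply `(ε φ)^(-α) ≥ ε`.
  set ε := D ^ (-(α / (1 + α))) with hε
  have hε0 : 0 < ε := Real.rpow_pos_of_pos hD0 _
  have hεD : (ε * D) ^ (-α) = ε := by
    have h1 : ε * D = D ^ (1 / (1 + α)) := by
      conv_lhs => rw [hε, ← Real.rpow_add_one hD0.ne']
      congr 1; field_simp; ring
    rw [h1, ← Real.rpow_mul hD0.le, hε]
    congr 1; field_simp
  set c := ε * (A / (b - a)) with hc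
  have hc0 : 0 < c := by positivity
  set m := c * d with hmdef
  have hm0 : 0 < m := by positivity
  have hv : SolvesOn univ (fun x => ε * φ x) (fun x => ε * q x) (fun x => ε * (K x - M x)) :=
    hφ.const_mul ε
  have hvlow : ∀ x ∈ Icc a b, c * min (x - a) (b - x) ≤ ε * φ x := fun x hx => by
    rw [hc, mul_assoc]
    exact mul_le_mul_of_nonneg_left (hφlow x hx) hε0.le
  have hvpos : ∀ x ∈ Ioo a b, 0 < ε * φ x := fun x hx =>
    (mul_pos hc0 (hminpos x hx)).trans_le (hvlow x (Ioo_subset_Icc_self hx))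
  have hvε : ∀ x ∈ Ioo a b, ε ≤ (ε * φ x) ^ (-α) := fun x hx => by
    conv_lhs => rw [← hεD]
    refine Real.rpow_le_rpow_of_nonpos (hvpos x hx) ?_ (by linarith)
    exact mul_le_mul_of_nonneg_left (hφD x (Ioo_subset_Icc_self hx)) hε0.le
  have hvm : ∀ x ∈ Ioo a b, 0 < M x → m ≤ ε * φ x := fun x hx hMx =>
    (mul_le_mul_of_nonneg_left (hdM x hx hMx) hc0.le).trans (hvlow x (Ioo_subset_Icc_self hx))
  have hlm : lam * m ^ (-γ) ≤ ε := by
    rw [Real.rpow_neg hm0.le, ← div_eq_mul_inv, div_le_iff₀ (Real.rpow_pos_of_pos hm0 _)]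
    refine hle.trans (le_of_eq ?_)
    have e1 : m = ε * (d / (b - a) * A) := by rw [hmdef, hc]; ring
    -- The requirement is `lam ≤ ε m^γ`; since `m` carries a factor `ε`, the power `ε^(1+γ)` yields
    -- the exponent of `D` in the bound on `lam`.
    have e2 : ε * ε ^ γ = (D ^ (α * ((1 + γ) / (1 + α))))⁻¹ := by
      have : ε * ε ^ γ = ε ^ (1 + γ) := by rw [Real.rpow_add hε0, Real.rpow_one]
      rw [this, hε, ← Real.rpow_mul hD0.le, ← Real.rpow_neg hD0.le]
      congr 1; field_simp
    rw [e1, Real.mul_rpow hε0.le (by positivity), Real.mul_rpow (by positivity) hA0.le,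
      ← mul_assoc, e2]
    ring
  -- The cap `m` makes the lower barrier `τ` work, and the cap `ε D` gives `τ^(-α) ≥ ε`.
  set τ₀ := min m (ε * D)
  have hτ₀ : 0 < τ₀ := lt_min hm0 (by positivity)
  set τ : ℕ → ℝ := fun n => τ₀ / (n + 1) with hτdef
  have hτ : ∀ n, 0 < τ n := fun n => by positivity
  have hττ : ∀ n, τ n ≤ τ₀ := fun n => div_le_self hτ₀.le (by
    have : (0 : ℝ) ≤ n := n.cast_nonneg
    linarith)
  have hτ_lim : Tendsto τ atTop (𝓝 0) := by
    have := (tendsto_one_div_add_atTop_nhds_zero_nat (𝕜 := ℝ)).const_mul τ₀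
    simpa [hτdef, div_eq_mul_inv] using this
  have hτε : ∀ n, ε ≤ τ n ^ (-α) := fun n => by
    conv_lhs => rw [← hεD]
    exact Real.rpow_le_rpow_of_nonpos (hτ n) ((hττ n).trans (min_le_right _ _)) (by linarith)
  choose U P hU hUa hUb hUlow using fun n => exists_regularized hab hα hγ hlam hK0 hM0 hK1 hM1
    hK2 hM2 hv (by simp [hφa]) (by simp [hφb]) hvε hm0 hvm hlm (hτ n)
    ((hττ n).trans (min_le_left _ _)) (hτε n)
  obtain ⟨w, r, hw, hwa, hwb⟩ := exists_solvesOn_zero_boundary hab hK1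
  have hwc : Continuous w := continuousOn_univ.1 hw.continuousOn
  have hw' : SolvesOn (Icc a b) w r K := hw.mono (subset_univ _)
  have hUup : ∀ n η, τ n ≤ η → ∀ x ∈ Icc a b, U n x ≤ η + η ^ (-α) * w x := fun n η hη =>
    (hU n).le_add_rpow_mul hα hlam hK0 hM0 ((hτ n).trans_le hη) (by rw [hUa]; exact hη)
      (by rw [hUb]; exact hη) hw' hwa hwb
  have hlow : ∀ n, ∀ x ∈ Icc a b, c * min (x - a) (b - x) ≤ U n x := fun n x hx =>
    (hvlow x hx).trans (hUlow n x hx).1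
  have hcpos : ∀ x ∈ Ioo a b, 0 < c * min (x - a) (b - x) := fun x hx =>
    mul_pos hc0 (hminpos x hx)
  obtain ⟨W, hW⟩ := isCompact_Icc.exists_bound_of_continuousOn (s := Icc a b) hwc.continuousOn
  obtain ⟨ψ, u, p, hψ, hlim, hu⟩ := exists_subseq_tendsto_solvesOn (U := U) (P := P)
    (C := τ₀ + τ₀ ^ (-α) * W) (w := fun x => c * min (x - a) (b - x))
    (G := rhs α γ lam K M)
    (H := fun t => K t * (c * min (t - a) (b - t)) ^ (-α) +
      lam * M t * (c * min (t - a) (b - t)) ^ (-γ)) hab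
    (fun n => (hU n).mono Ioo_subset_Icc_self)
    (fun n x hx => by
      have hx' := Ioo_subset_Icc_self hx
      rw [abs_of_pos ((hcpos x hx).trans_le (hlow n x hx'))]
      refine (hUup n τ₀ (hττ n) x hx').trans ?_
      gcongr
      exact (le_abs_self _).trans (hW x hx'))
    hcpos (fun n x hx => hlow n x (Ioo_subset_Icc_self hx))
    (fun t _ => by
      have h : ∀ β : ℝ, ContinuousOn (fun ξ : ℝ => ξ ^ (-β)) (Ioi 0) := fun β ξ hξ =>
        (Real.continuousAt_rpow_const _ _ (Or.inl (ne_of_gt hξ))).continuousWithinAt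
      exact (continuousOn_const.mul (h α)).sub (continuousOn_const.mul (h γ)))
    (fun x hx y hy => by
      have hss := ordConnected_Ioo.uIcc_subset hx hy
      have h : ∀ β : ℝ, ContinuousOn (fun t : ℝ => (c * min (t - a) (b - t)) ^ (-β))
          (uIcc x y) := fun β => by
        refine ContinuousOn.rpow_const (by fun_prop) fun t ht => Or.inl (hcpos t (hss ht)).ne'
      exact (hK1.intervalIntegrable.mul_continuousOn (h α)).add
        ((hM1.intervalIntegrable.const_mul lam).mul_continuousOn (h γ)))
    (fun n t ht => abs_rhs_le hα hγ hlam (hK0 t) (hM0 t) (hcpos t ht)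
      (hlow n t (Ioo_subset_Icc_self ht)))
  classical
  -- The limit is determined only inside `Ω`; the boundary value `0` is imposed here and continuity
  -- at the ends is proved afterwards.
  set v : ℝ → ℝ := (Ioo a b).indicator u with hvdef
  have hvu : ∀ x ∈ Ioo a b, v x = u x := fun x hx => indicator_of_mem hx u
  have hva : v a = 0 := indicator_of_notMem (by simp) u
  have hvb : v b = 0 := indicator_of_notMem (by simp) u
  have hends : ∀ x ∈ Icc a b, x ∉ Ioo a b → x = a ∨ x = b := fun x hx hx' => by
    by_contra! hcon
    exact hx' ⟨lt_of_le_of_ne hx.1 hcon.1.symm, lt_of_le_of_ne hx.2 hcon.2⟩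
  have hv_low : ∀ x ∈ Icc a b, c * min (x - a) (b - x) ≤ v x := fun x hx => by
    by_cases hxo : x ∈ Ioo a b
    · rw [hvu x hxo]
      exact ge_of_tendsto' (hlim x hxo) fun n => hlow _ x hx
    · rcases hends x hx hxo with rfl | rfl
      · simp [hva, hab.le]
      · simp [hvb, hab.le]
  have hw0 : ∀ x ∈ Icc a b, 0 ≤ w x :=
    (SolvesOn.const 0).le_of_le hw' hwa.ge hwb.ge (ae_of_all _ fun s _ _ => hK0 s)
  have hv_up : ∀ η > 0, ∀ x ∈ Icc a b, v x ≤ η + η ^ (-α) * w x := fun η hη x hx => by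
    by_cases hxo : x ∈ Ioo a b
    · rw [hvu x hxo]
      refine le_of_tendsto (hlim x hxo) ?_
      filter_upwards [(hτ_lim.comp hψ.tendsto_atTop).eventually (eventually_le_nhds hη)] with n hn
      exact hUup _ η hn x hx
    · have h0 : v x = 0 := by rcases hends x hx hxo with rfl | rfl <;> assumption
      rw [h0]
      have := hw0 x hx
      positivity
  have hcont_end : ∀ z, v z = 0 → w z = 0 → ContinuousWithinAt v (Icc a b) z := by
    intro z hz hwz
    rw [ContinuousWithinAt, hz, Metric.tendsto_nhds]
    intro ε' hε'
    -- Half of `ε'` is the height `η` of the barrier; the other half absorbs `η^(-α) w`, which tends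
    -- to `0` at the endpoint.
    have hη : 0 < ε' / 2 := by positivity
    have h1 : Tendsto (fun x => ε' / 2 + (ε' / 2) ^ (-α) * w x) (𝓝[Icc a b] z)
        (𝓝 (ε' / 2 + (ε' / 2) ^ (-α) * w z)) :=
      (continuous_const.add (continuous_const.mul hwc)).continuousAt.continuousWithinAt
    have h2 := h1.eventually (gt_mem_nhds (show _ < ε' by rw [hwz]; linarith))
    filter_upwards [h2, self_mem_nhdsWithin] with x hx1 hx2
    have h3 := hv_low x hx2
    have h4 := mul_nonneg hc0.le (hmin0 x hx2)
    rw [Real.dist_eq, sub_zero, abs_of_nonneg (h4.trans h3)]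
    exact (hv_up _ hη x hx2).trans_lt hx1
  refine ⟨v, p, c, hc0, fun x hx => ?_, hva, hvb, hv_low, fun x hx => ?_, ?_, ?_⟩
  · by_cases hxo : x ∈ Ioo a b
    · refine (((hu.1 x hxo).continuousAt).congr ?_).continuousWithinAt
      filter_upwards [isOpen_Ioo.mem_nhds hxo] with y hy using (hvu y hy).symm
    · rcases hends x hx hxo with rfl | rfl
      exacts [hcont_end _ hva hwa, hcont_end _ hvb hwb]
  · refine (hu.1 x hx).congr_of_eventuallyEq ?_
    filter_upwards [isOpen_Ioo.mem_nhds hx] with y hy using hvu y hy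
  · exact (hu.congr_ae ordConnected_Ioo (ae_of_all _ fun t ht => by rw [hvu t ht])).2
  · exact (hu.congr_ae ordConnected_Ioo (ae_of_all _ fun t ht => by rw [hvu t ht])).3

end Existence

/-! ### The distance to the boundary -/

theorem bdry_eq {a b : ℝ} (hab : a < b) : bdry a b = {a, b} := frontier_Ioo hab

theorem infEDist_bdry {a b x : ℝ} (hab : a < b) (hx : x ∈ Icc a b) :
    Metric.infEDist x (bdry a b) = ENNReal.ofReal (min (x - a) (b - x)) := by
  rw [bdry_eq hab, insert_eq, Metric.infEDist_union, Metric.infEDist_singleton,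
    Metric.infEDist_singleton, edist_dist, edist_dist, Real.dist_eq, Real.dist_eq,
    abs_of_nonneg (by linarith [hx.1]), abs_sub_comm, abs_of_nonneg (by linarith [hx.2]),
    ENNReal.ofReal_min]

theorem delta_eq {a b x : ℝ} (hab : a < b) (hx : x ∈ Icc a b) :
    delta a b x = min (x - a) (b - x) := by
  rw [delta, Metric.infDist, infEDist_bdry hab hx, ENNReal.toReal_ofReal]
  exact le_min (by linarith [hx.1]) (by linarith [hx.2])

/-! ### Test functions -/

theorem exists_interval_of_tsupport_subset {a b : ℝ} (hab : a < b) {f : ℝ → ℝ}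
    (hf : HasCompactSupport f) (hs : tsupport f ⊆ Ioo a b) :
    ∃ c e, c ∈ Ioo a b ∧ e ∈ Ioo a b ∧ c < e ∧ tsupport f ⊆ Ioo c e := by
  set m := (a + b) / 2
  have hm : m ∈ Ioo a b := ⟨by simp only [m]; linarith, by simp only [m]; linarith⟩
  have hT : IsCompact (insert m (tsupport f)) := IsCompact.insert hf m
  have hTn : (insert m (tsupport f)).Nonempty := ⟨m, mem_insert _ _⟩
  have hTs : insert m (tsupport f) ⊆ Ioo a b := insert_subset hm hs
  obtain ⟨c, hc1, hc2⟩ := exists_between (hTs (hT.sInf_mem hTn)).1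
  obtain ⟨e, he1, he2⟩ := exists_between (hTs (hT.sSup_mem hTn)).2
  have hin : insert m (tsupport f) ⊆ Ioo c e := fun x hx =>
    ⟨hc2.trans_le (csInf_le hT.bddBelow hx), (le_csSup hT.bddAbove hx).trans_lt he1⟩
  have hcm := hin (mem_insert _ _)
  exact ⟨c, e, ⟨hc1, hcm.1.trans hm.2⟩, ⟨hm.1.trans hcm.2, he2⟩, hcm.1.trans hcm.2,
    (subset_insert _ _).trans hin⟩

theorem setIntegral_mul_eq_interval {a b c e : ℝ} {F f : ℝ → ℝ} (hc : c ∈ Ioo a b)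
    (he : e ∈ Ioo a b) (hce : c < e) (hf : ∀ x, x ∉ Ioo c e → f x = 0) :
    ∫ x in Ioo a b, F x * f x = ∫ x in c..e, F x * f x := by
  rw [integral_of_le hce.le]
  refine setIntegral_eq_of_subset_of_forall_sdiff_eq_zero measurableSet_Ioo
    (fun x hx => ⟨hc.1.trans hx.1, hx.2.trans_lt he.2⟩) fun x hx => ?_
  rw [hf x fun h => hx.2 (Ioo_subset_Ioc_self h), mul_zero]

theorem deriv_eq_zero_of_notMem_tsupport {f : ℝ → ℝ} {x : ℝ} (hx : x ∉ tsupport f) :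
    deriv f x = 0 :=
  image_eq_zero_of_notMem_tsupport fun h => hx (tsupport_deriv_subset h)

/-! ### Weak formulation and regularity up to the boundary. -/

section Weak

variable {a b : ℝ} {u p g f : ℝ → ℝ}

theorem SolvesOn.setIntegral_deriv_mul (hab : a < b) (hu : SolvesOn (Ioo a b) u p g)
    (hf : ContDiff ℝ 1 f) (hfc : HasCompactSupport f) (hfs : tsupport f ⊆ Ioo a b) :
    ∫ x in Ioo a b, p x * deriv f x = ∫ x in Ioo a b, g x * f x := by
  obtain ⟨c, e, hc, he, hce, hs⟩ := exists_interval_of_tsupport_subset hab hfc hfs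
  have h0 : ∀ x, x ∉ Ioo c e → f x = 0 := fun x hx =>
    image_eq_zero_of_notMem_tsupport fun h => hx (hs h)
  rw [setIntegral_mul_eq_interval hc he hce h0, setIntegral_mul_eq_interval hc he hce
    fun x hx => deriv_eq_zero_of_notMem_tsupport fun h => hx (hs h)]
  obtain ⟨L, hL⟩ := hf.lipschitzWith_of_hasCompactSupport hfc one_ne_zero
  rw [hu.integral_mul_deriv ordConnected_Ioo hc he hL.lipschitzOnWith.absolutelyContinuousOnInterval,
    h0 c (by simp), h0 e (by simp)]
  ring

theorem SolvesOn.setIntegral_mul_deriv (hab : a < b) (hu : SolvesOn (Ioo a b) u p g)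
    (hf : ContDiff ℝ 1 f) (hfc : HasCompactSupport f) (hfs : tsupport f ⊆ Ioo a b) :
    ∫ x in Ioo a b, u x * deriv f x = -∫ x in Ioo a b, p x * f x := by
  obtain ⟨c, e, hc, he, hce, hs⟩ := exists_interval_of_tsupport_subset hab hfc hfs
  have h0 : ∀ x, x ∉ Ioo c e → f x = 0 := fun x hx =>
    image_eq_zero_of_notMem_tsupport fun h => hx (hs h)
  rw [setIntegral_mul_eq_interval hc he hce h0, setIntegral_mul_eq_interval hc he hce
    fun x hx => deriv_eq_zero_of_notMem_tsupport fun h => hx (hs h)]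
  rw [integral_mul_deriv_eq_deriv_mul
    (fun x hx => hu.1 x (ordConnected_Ioo.uIcc_subset hc he hx))
    (fun x _ => (hf.differentiable one_ne_zero x).hasDerivAt)
    (hu.continuousOn_deriv_uIcc ordConnected_Ioo hc he).intervalIntegrable
    ((hf.continuous_deriv le_rfl).intervalIntegrable _ _), h0 c (by simp), h0 e (by simp)]
  ring

theorem SolvesOn.isWeakDeriv_one (hab : a < b) (hu : SolvesOn (Ioo a b) u p g) :
    IsWeakDeriv a b 1 u p := fun φ => by
  have h1 := hu.setIntegral_mul_deriv hab (φ.contDiff.of_le (by simp)) φ.hasCompactSupport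
    φ.tsupport_subset
  simpa [iteratedDeriv_one] using h1

theorem SolvesOn.isWeakDeriv_two (hab : a < b) (hu : SolvesOn (Ioo a b) u p g) :
    IsWeakDeriv a b 2 u (fun x => -g x) := fun φ => by
  have hφ : ContDiff ℝ 2 φ := mod_cast contDiff_infty.1 φ.contDiff 2
  have hφ' : ContDiff ℝ 1 (deriv φ) := (contDiff_succ_iff_deriv (n := 1).1 hφ).2.2
  have h1 := hu.setIntegral_mul_deriv hab hφ' φ.hasCompactSupport.deriv
    (tsupport_deriv_subset.trans φ.tsupport_subset)
  have h2 := hu.setIntegral_deriv_mul hab (hφ.of_le (by norm_num)) φ.hasCompactSupport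
    φ.tsupport_subset
  have h3 : iteratedDeriv 2 φ = deriv (deriv φ) := by
    rw [iteratedDeriv_succ, iteratedDeriv_one]
  rw [h3, h1, h2]
  simp [MeasureTheory.integral_neg]

theorem SolvesOn.locallyIntegrableOn (hu : SolvesOn (Ioo a b) u p g) :
    LocallyIntegrableOn g (Ioo a b) := by
  intro x hx
  obtain ⟨c, hc1, hc2⟩ := exists_between hx.1
  obtain ⟨e, he1, he2⟩ := exists_between hx.2
  have h := hu.2 c ⟨hc1, hc2.trans hx.2⟩ e ⟨hx.1.trans he1, he2⟩
  exact ⟨Ioc c e, mem_nhdsWithin_of_mem_nhds (Ioc_mem_nhds hc2 he1),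
    (intervalIntegrable_iff_integrableOn_Ioc_of_le (hc2.trans he1).le).1 h⟩

theorem SolvesOn.isSolution {F : ℝ → ℝ → ℝ} (hab : a < b)
    (hu : SolvesOn (Ioo a b) u p (fun x => F x (u x))) (hc : ContinuousOn u (Icc a b))
    (hpos : ∀ x ∈ Ioo a b, 0 < u x) (ha : u a = 0) (hb : u b = 0) : IsSolution a b F u where
  contDiffOn := by
    rw [show (1 : WithTop ℕ∞) = 0 + 1 by simp, contDiffOn_succ_iff_deriv_of_isOpen isOpen_Ioo]
    refine ⟨fun x hx => (hu.1 x hx).differentiableAt.differentiableWithinAt, by simp,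
      contDiffOn_zero.2 ?_⟩
    exact (hu.continuousOn_deriv ordConnected_Ioo isOpen_Ioo).congr fun x hx => (hu.1 x hx).deriv
  continuousOn := by rwa [closure_Ioo hab.ne]
  pos := hpos
  eq_zero := by
    rw [bdry_eq hab]
    rintro x (rfl | rfl) <;> assumption
  locallyIntegrableOn := hu.locallyIntegrableOn
  weak_eq := fun φ => by
    rw [← hu.setIntegral_deriv_mul hab (φ.contDiff.of_le (by simp)) φ.hasCompactSupport
      φ.tsupport_subset]
    exact setIntegral_congr_fun measurableSet_Ioo fun x hx => by
      simp only [(hu.1 x hx).deriv]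

/-- If the right-hand side is integrable up to the boundary, the solution is the restriction of a
`C¹` function on the line. -/
theorem SolvesOn.exists_extension (hab : a < b) (hu : SolvesOn (Ioo a b) u p g)
    (hc : ContinuousOn u (Icc a b)) (hg : IntegrableOn g (Ioo a b)) :
    ∃ v q, (∀ x, HasDerivAt v (q x) x) ∧ Continuous q ∧ EqOn u v (Icc a b) ∧
      EqOn p q (Ioo a b) := by
  set m := (a + b) / 2
  have hm : m ∈ Ioo a b := ⟨by simp only [m]; linarith, by simp only [m]; linarith⟩
  -- Extending `g` by zero and integrating twice from the midpoint gives a `C¹` function on the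
  -- line; it equals `u` inside `Ω`, hence on the closure by continuity.
  have hv := solvesOn_primitive (hg.integrable_indicator measurableSet_Ioo) m (u m) (p m)
  set q : ℝ → ℝ := fun y => p m - ∫ t in m..y, (Ioo a b).indicator g t with hq
  have hqc : Continuous q := continuousOn_univ.1 (hv.continuousOn_deriv ordConnected_univ isOpen_univ)
  set v : ℝ → ℝ := fun x => u m + ∫ y in m..x, q y with hvd
  have hpq : EqOn p q (Ioo a b) := fun x hx => by
    have h1 : ∫ t in m..x, (Ioo a b).indicator g t = ∫ t in m..x, g t :=
      intervalIntegral.integral_congr fun t ht =>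
        indicator_of_mem (ordConnected_Ioo.uIcc_subset hm hx ht) g
    simp only [hq, h1]
    linarith [hu.3 m hm x hx]
  have huv : EqOn u v (Ioo a b) := fun x hx => by
    have h1 : ∫ t in m..x, q t = ∫ t in m..x, p t :=
      intervalIntegral.integral_congr fun t ht =>
        (hpq (ordConnected_Ioo.uIcc_subset hm hx ht)).symm
    simp only [hvd, h1, hu.integral_deriv ordConnected_Ioo hm hx]
    ring
  refine ⟨v, q, fun x => hv.1 x trivial, hqc, ?_, hpq⟩
  have hvc : ContinuousOn v (Icc a b) := hv.continuousOn.mono (subset_univ _)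
  exact huv.of_subset_closure hc hvc Ioo_subset_Icc_self (closure_Ioo hab.ne).ge

theorem SolvesOn.memW2_and_isC1Zero (hab : a < b) (hu : SolvesOn (Ioo a b) u p g)
    (hc : ContinuousOn u (Icc a b)) (ha : u a = 0) (hb : u b = 0) {r : ℝ≥0∞} (hr : 1 ≤ r)
    (hg : InLp a b r g) : MemW2 a b r u ∧ IsC1Zero a b u := by
  obtain ⟨v, q, hv, hq, huv, hpq⟩ := hu.exists_extension hab hc (hg.integrable hr)
  have hvc : Continuous v := continuous_iff_continuousAt.2 fun x => (hv x).continuousAt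
  have hLp : ∀ {w : ℝ → ℝ}, Continuous w → InLp a b r w := fun {w} hw => by
    obtain ⟨C, hC⟩ := isCompact_Icc.exists_bound_of_continuousOn (s := Icc a b) hw.continuousOn
    exact MemLp.of_bound hw.aestronglyMeasurable C ((ae_restrict_iff' measurableSet_Ioo).2
      (ae_of_all _ fun x hx => hC x (Ioo_subset_Icc_self hx)))
  have hcongr : ∀ {w z : ℝ → ℝ}, InLp a b r z → EqOn w z (Ioo a b) → InLp a b r w :=
    fun {w z} hz h => MemLp.ae_eq ((ae_restrict_iff' measurableSet_Ioo).2
      (ae_of_all _ fun x hx => (h hx).symm)) hz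
  refine ⟨⟨hcongr (hLp hvc) (huv.mono Ioo_subset_Icc_self), ⟨p, hcongr (hLp hq) hpq,
    hu.isWeakDeriv_one hab⟩, ⟨_, hg.neg, hu.isWeakDeriv_two hab⟩⟩, ?_, ?_⟩
  · have h1 : ContDiff ℝ 1 v := by
      rw [contDiff_one_iff_deriv]
      refine ⟨fun x => (hv x).differentiableAt, ?_⟩
      rwa [show deriv v = q from funext fun x => (hv x).deriv]
    exact h1.contDiffOn.congr huv
  · rw [bdry_eq hab]
    rintro x (rfl | rfl) <;> assumption

end Weak

/-- A function in `C¹₀` lying above a positive multiple of the distance to the boundary is interior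
to the cone of nonnegative functions. -/
theorem IsC1Zero.inConeInterior {a b c : ℝ} {u : ℝ → ℝ} (hab : a < b) (hu : IsC1Zero a b u)
    (hc : 0 < c) (hlow : ∀ x ∈ Icc a b, c * min (x - a) (b - x) ≤ u x) :
    InConeInterior a b u := by
  refine ⟨hu, c, hc, fun v hv hvu x hx => ?_⟩
  have hbd : ∀ {w : ℝ → ℝ}, IsC1Zero a b w → w a = 0 ∧ w b = 0 := fun {w} hw => by
    have := hw.2
    rw [bdry_eq hab] at this
    exact ⟨this a (by simp), this b (by simp)⟩
  have hdv := hv.1.differentiableOn one_ne_zero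
  have hdu := hu.1.differentiableOn one_ne_zero
  -- Derivatives within `c` of each other and equal values at both ends give `|v - u| ≤ c δ ≤ u`;
  -- the radius `c` is the constant of the lower bound.
  have hle : ∀ y ∈ Icc a b, ∀ z ∈ Icc a b, ‖(v z - u z) - (v y - u y)‖ ≤ c * ‖z - y‖ :=
    fun y hy z hz => (convex_Icc a b).norm_image_sub_le_of_norm_hasDerivWithin_le
      (fun t ht => (hdv t ht).hasDerivWithinAt.sub (hdu t ht).hasDerivWithinAt)
      (fun t ht => (hvu t ht).2.le) hy hz
  have h1 := hle a (left_mem_Icc.2 hab.le) x hx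
  have h2 := hle b (right_mem_Icc.2 hab.le) x hx
  rw [(hbd hv).1, (hbd hu).1, Real.norm_eq_abs, Real.norm_eq_abs,
    abs_of_nonneg (by linarith [hx.1] : 0 ≤ x - a)] at h1
  rw [(hbd hv).2, (hbd hu).2, Real.norm_eq_abs, Real.norm_eq_abs,
    abs_of_nonpos (by linarith [hx.2] : x - b ≤ 0)] at h2
  have h3 := hlow x hx
  have h4 := (abs_le.1 h1).1
  have h5 := (abs_le.1 h2).1
  rcases le_total (x - a) (b - x) with h | h
  · rw [min_eq_left h] at h3; linarith
  · rw [min_eq_right h] at h3; linarith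

/-! ### Translation of the weights and of the bound on `lam`. -/

section Weights

variable {a b : ℝ} {h k : ℝ → ℝ}

theorem integral_mul_congr_Ioo (hab : a ≤ b) {w z : ℝ → ℝ} (hwz : ∀ x ∈ Ioo a b, w x = z x)
    (hhk : ∀ᵐ x, x ∈ Ioo a b → h x = k x) :
    ∫ x in a..b, w x * h x = ∫ x in a..b, z x * k x := by
  rw [integral_of_le hab, integral_of_le hab, integral_Ioc_eq_integral_Ioo,
    integral_Ioc_eq_integral_Ioo]
  refine setIntegral_congr_ae measurableSet_Ioo ?_
  filter_upwards [hhk] with x hx hxI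
  rw [hx hxI, hwz x hxI]

theorem deltaWeight_congr (hab : a < b) (hhk : ∀ᵐ x, x ∈ Ioo a b → h x = k x) :
    deltaWeight a b h = ∫ x in a..b, min (x - a) (b - x) * k x := by
  rw [deltaWeight, ← integral_mul_congr_Ioo hab.le
    (fun x hx => delta_eq hab (Ioo_subset_Icc_self hx)) hhk]
  simp only [mul_comm]

theorem maxWeight_congr (hab : a < b) (hhk : ∀ᵐ x, x ∈ Ioo a b → h x = k x) :
    maxWeight a b h = max (∫ x in a..b, (x - a) * k x) (∫ x in a..b, (b - x) * k x) := by
  rw [maxWeight]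
  simp only [leftWeight, rightWeight]
  rw [integral_mul_congr_Ioo hab.le (w := fun x => x - a) (fun _ _ => rfl) hhk,
    integral_mul_congr_Ioo hab.le (w := fun x => b - x) (fun _ _ => rfl) hhk]

end Weights

/-- Membership of the right-hand side in `L^r`, for a function that dominates a multiple of the
distance to the boundary. -/
theorem inLp_rhs {a b α γ lam c : ℝ} {K M u p : ℝ → ℝ} (hab : a < b) (hα : 0 < α) (hγ : 0 < γ)
    (hlam : 0 < lam) (hK0 : ∀ᵐ x ∂(volume.restrict (Ioo a b)), 0 ≤ K x)
    (hM0 : ∀ x ∈ Ioo a b, 0 ≤ M x) (hc : 0 < c)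
    (hlow : ∀ x ∈ Icc a b, c * min (x - a) (b - x) ≤ u x)
    (hu : SolvesOn (Ioo a b) u p (fun x => rhs α γ lam K M x (u x))) {r : ℝ≥0∞}
    (hK : InLp a b r fun x => K x * delta a b x ^ (-α))
    (hM : InLp a b r fun x => M x * delta a b x ^ (-γ)) :
    InLp a b r fun x => rhs α γ lam K M x (u x) := by
  refine MemLp.mono' (g := fun x => c ^ (-α) * (K x * delta a b x ^ (-α)) +
    lam * c ^ (-γ) * (M x * delta a b x ^ (-γ))) ?_ ?_ ?_
  · exact (hK.const_mul (c ^ (-α))).add (hM.const_mul (lam * c ^ (-γ)))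
  · exact hu.locallyIntegrableOn.aestronglyMeasurable
  · filter_upwards [hK0, ae_restrict_mem measurableSet_Ioo] with x hKx hx
    have hx' := Ioo_subset_Icc_self hx
    have hpos : 0 < min (x - a) (b - x) := lt_min (by linarith [hx.1]) (by linarith [hx.2])
    refine (abs_rhs_le hα hγ hlam hKx (hM0 x hx) (mul_pos hc hpos) (hlow x hx')).trans
      (le_of_eq ?_)
    rw [delta_eq hab hx', Real.mul_rpow hc.le hpos.le, Real.mul_rpow hc.le hpos.le]
    ring

/-- The bound on `lam` in `ℝ≥0∞` in terms of a real lower bound for the distance of the support of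
`M` to the boundary. -/
theorem exists_dist_of_le {a b γ lam X : ℝ} {S : Set ℝ} (hab : a < b) (hγ : 0 < γ) (hlam : 0 < lam)
    (hX : 0 < X) (hS : S ⊆ Ioo a b)
    (hle : ENNReal.ofReal lam ≤
      (distToBdry a b S / ENNReal.ofReal (b - a)) ^ γ * ENNReal.ofReal X) :
    ∃ d, 0 < d ∧ (∀ x ∈ S, d ≤ min (x - a) (b - x)) ∧ lam ≤ (d / (b - a)) ^ γ * X := by
  have hba : 0 < b - a := sub_pos.2 hab
  rcases S.eq_empty_or_nonempty with rfl | ⟨y, hy⟩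
  -- With `S` empty the distance is infinite and any `d` is allowed; this one makes the required
  -- inequality an equality.
  · refine ⟨(b - a) * (lam / X) ^ (1 / γ), by positivity, by simp, ?_⟩
    rw [mul_div_cancel_left₀ _ hba.ne', ← Real.rpow_mul (by positivity), one_div,
      inv_mul_cancel₀ hγ.ne', Real.rpow_one, div_mul_cancel₀ _ hX.ne']
  · have hmin : ∀ x ∈ S, distToBdry a b S ≤ ENNReal.ofReal (min (x - a) (b - x)) := fun x hx => by
      rw [← infEDist_bdry hab (Ioo_subset_Icc_self (hS hx))]
      exact iInf₂_le x hx
    have hfin : distToBdry a b S ≠ ⊤ := ne_top_of_le_ne_top ENNReal.ofReal_ne_top (hmin y hy)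
    -- A zero distance would make the upper bound for `lam > 0` vanish.
    have hpos : 0 < (distToBdry a b S).toReal := by
      refine ENNReal.toReal_pos (fun h0 => ?_) hfin
      rw [h0, ENNReal.zero_div, ENNReal.zero_rpow_of_pos hγ, zero_mul] at hle
      exact absurd hle (not_le.2 (ENNReal.ofReal_pos.2 hlam))
    refine ⟨_, hpos, fun x hx => ?_, ?_⟩
    · refine ENNReal.toReal_le_of_le_ofReal ?_ (hmin x hx)
      exact le_min (by linarith [(hS hx).1]) (by linarith [(hS hx).2])
    · rw [← ENNReal.ofReal_toReal hfin, ← ENNReal.ofReal_div_of_pos hba,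
        ENNReal.ofReal_rpow_of_pos (by positivity), ← ENNReal.ofReal_mul (by positivity)] at hle
      exact (ENNReal.ofReal_le_ofReal_iff (by positivity)).1 hle

end SingularODE

theorem mainTheorem3 (a b : ℝ) (hab : a < b) (α γ : ℝ) (hα : 0 < α) (hγ : 0 < γ)
    (K M : ℝ → ℝ)
    (hK0 : ∀ᵐ x ∂(volume.restrict (Ioo a b)), 0 ≤ K x) (hK : SingularODE.InLp a b 2 K)
    (hM0 : ∀ x ∈ Ioo a b, 0 ≤ M x) (hM : SingularODE.InLp a b 2 M)
    (hMc : ContinuousOn M (Ioo a b))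
    (hMsupp : closure (SingularODE.posSet a b M) ⊆ Ioo a b)
    (hip : SingularODE.maxWeight a b M < SingularODE.deltaWeight a b K) :
    ∃ lam₀ : ℝ≥0∞,
      (SingularODE.distToBdry a b (SingularODE.posSet a b M) / ENNReal.ofReal (b - a)) ^ γ *
        ENNReal.ofReal
          ((SingularODE.deltaWeight a b K - SingularODE.maxWeight a b M) ^ γ /
            ((1 / 2) * (SingularODE.maxWeight a b K - SingularODE.deltaWeight a b M)) ^
              (α * ((1 + γ) / (1 + α)))) ≤ lam₀ ∧
      ∀ lam : ℝ, 0 < lam → ENNReal.ofReal lam ≤ lam₀ →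
        ∃ u : ℝ → ℝ, SingularODE.IsSolution a b (SingularODE.rhs α γ lam K M) u ∧
          ∀ r : ℝ≥0∞, 1 < r →
            SingularODE.InLp a b r (fun x => K x * SingularODE.delta a b x ^ (-α)) →
            SingularODE.InLp a b r (fun x => M x * SingularODE.delta a b x ^ (-γ)) →
            (∃ q : ℝ≥0∞, 1 < q ∧ SingularODE.MemW2 a b q u) ∧
              SingularODE.InConeInterior a b u := by
  -- `lam₀` is taken equal to the stated lower bound, in `ℝ≥0∞`.
  open SingularODE in
  refine ⟨_, le_rfl, fun lam hlam hle => ?_⟩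
  -- The data are replaced by globally defined, everywhere nonnegative representatives, which
  -- changes neither the integrals nor the equation almost everywhere in `Ω`.
  set k : ℝ → ℝ := (Ioo a b).indicator fun x => max (K x) 0
  set m : ℝ → ℝ := (Ioo a b).indicator M
  have hKk : ∀ᵐ x, x ∈ Ioo a b → K x = k x := by
    filter_upwards [(ae_restrict_iff' measurableSet_Ioo).1 hK0] with x hx hxI
    simp only [k, indicator_of_mem hxI, max_eq_left (hx hxI)]
  have hMm : ∀ x ∈ Ioo a b, M x = m x := fun x hx => (indicator_of_mem hx M).symm
  have hk0 : ∀ x, 0 ≤ k x := fun x => indicator_nonneg (fun _ _ => le_max_right _ _) x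
  have hm0 : ∀ x, 0 ≤ m x := fun x => indicator_nonneg hM0 x
  have hk2 : MemLp k 2 := by
    rw [memLp_indicator_iff_restrict measurableSet_Ioo]
    refine hK.ae_eq ?_
    filter_upwards [hK0] with x hx using (max_eq_left hx).symm
  have hm2 : MemLp m 2 := (memLp_indicator_iff_restrict measurableSet_Ioo).2 hM
  have hk1 : Integrable k := by
    rw [integrable_indicator_iff measurableSet_Ioo]
    exact ((memLp_indicator_iff_restrict measurableSet_Ioo).1 hk2).integrable one_le_two
  have hm1 : Integrable m :=
    (integrable_indicator_iff measurableSet_Ioo).2 (hM.integrable one_le_two)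
  rw [deltaWeight_congr hab hKk, maxWeight_congr hab (ae_of_all _ hMm)] at hip
  rw [deltaWeight_congr hab hKk, deltaWeight_congr hab (ae_of_all _ hMm),
    maxWeight_congr hab (ae_of_all _ hMm), maxWeight_congr hab hKk] at hle
  have hA := sub_pos.2 hip
  have hX := div_pos (Real.rpow_pos_of_pos hA γ) (Real.rpow_pos_of_pos
    (show 0 < 1 / 2 * (max (∫ t in a..b, (t - a) * k t) (∫ t in a..b, (b - t) * k t) -
      ∫ t in a..b, min (t - a) (b - t) * m t) by
        have h1 := integral_min_mul_le hab.le hk1 hk0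
        have h2 := integral_min_mul_le hab.le hm1 hm0
        have h3 := le_max_left (∫ t in a..b, (t - a) * k t) (∫ t in a..b, (b - t) * k t)
        have h4 := le_max_left (∫ t in a..b, (t - a) * m t) (∫ t in a..b, (b - t) * m t)
        linarith) (α * ((1 + γ) / (1 + α))))
  obtain ⟨d, hd, hdM, hlamd⟩ := exists_dist_of_le hab hγ hlam hX (fun x hx => hx.1) hle
  obtain ⟨u, p, c, hc, huc, hua, hub, hlow, hsol⟩ := exists_solvesOn_rhs hab hα hγ hlam hk0 hm0
    hk1 hm1 hk2 hm2 rfl rfl hA hd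
    (fun x hx hmx => hdM x ⟨hx, by rwa [hMm x hx]⟩) hlamd
  have hsol' : SolvesOn (Ioo a b) u p (fun x => rhs α γ lam K M x (u x)) := by
    refine hsol.congr_ae ordConnected_Ioo ?_
    filter_upwards [hKk] with x hx hxI
    simp only [rhs, hx hxI, hMm x hxI]
  refine ⟨u, hsol'.isSolution hab huc (fun x hx => ?_) hua hub, fun r hr hKr hMr => ?_⟩
  · refine lt_of_lt_of_le (mul_pos hc (lt_min ?_ ?_)) (hlow x (Ioo_subset_Icc_self hx))
    exacts [sub_pos.2 hx.1, sub_pos.2 hx.2]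
  -- The exponent `q` is `r` itself.
  · obtain ⟨hW, hC1⟩ := hsol'.memW2_and_isC1Zero hab huc hua hub hr.le
      (inLp_rhs hab hα hγ hlam hK0 hM0 hc hlow hsol' hKr hMr)
    exact ⟨⟨r, hr, hW⟩, hC1.inConeInterior hab hc hlow⟩
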